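/- **Setting.** Let $l,L>0$, $\Omega=(-l,l)\times(-L,\infty)\subset\mathbb R^2$, $\Lambda\in[0,\infty]$, and let $\mathcal H^1$, $\mathcal L^2$ be the length and area measures. Call $K\subset\mathbb R^2$ *$\mathcal H^1$-rectifiable* if $\mathcal H^1(K)<\infty$ and $\lim_{r\to0^+}\mathcal H^1(K\cap B_r(x))/(2r)=1$ for $\mathcal H^1$-a.e. $x\in K$ (sets of length zero are allowed). A *height* is an upper semicontinuous function $h:[-l,l]\to[0,\infty)$ of finite pointwise variation with $h\le\Lambda$, and $S_h=\{(x,y):-l\le x\le l,\ y\le h(x)\}$. A *crack set* for $h$ is a closed $\mathcal H^1$-rectifiable set $K\subset\overline\Omega\cap\overline{\mathrm{Int}(S_h)}$. For such a pair put $S_{h,K}=(S_h\setminus K)\cap\overline\Omega$. For $\alpha\ge1$, $\mathcal B^\alpha$ is the family of tuples $(S_{h^\alpha,K^\alpha},\dots,S_{h^0,K^0})$ of such sets with $h^{i-1}\le h^i$ and $\partial S_{h^i,K^i}\cap\mathrm{Int}(S_{h^{i-1},K^{i-1}})=\emptyset$ for $i=1,\dots,\alpha$. For $\mathbf m=(m_0,\dots,m_\alpha)\in\mathbb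 N^{\alpha+1}$, $\mathcal B^\alpha_{\mathbf m}$ is the subfamily for which $\partial S_{h^i,K^i}$ has at most $m_i$ connected components for every $i$. Let $\mathrm{sdist}(x,\partial E)=\mathrm{dist}(x,E)$ for $x\notin E$ and $-\mathrm{dist}(x,\mathbb R^2\setminus E)$ for $x\in E$. A sequence $(S^\alpha_k,\dots,S^0_k)\in\mathcal B^\alpha$ *$\tau_{\mathcal B^\alpha}$-converges* to $(S^\alpha,\dots,S^0)\in\mathcal B^\alpha$ if, for every $i=0,\dots,\alpha$, $\sup_k\mathcal H^1(\partial S^i_k)<\infty$ and $\mathrm{sdist}(\cdot,\partial S^i_k)\to\mathrm{sdist}(\cdot,\partial S^i)$ locally uniformly in $\mathbb R^2$. Let $\varphi_j$ $(0\le j\le\alpha)$ and $\varphi_{ij}$ $(0\le i<j\le\alpha)$ be functions on $\overline\Omega\times\mathbb R^2$, and put $\varphi^1_{ij}=\min\{\varphi_i,\varphi_j+\varphi_{ij}\}$, $\varphi^2_{ij}=\min\{\varphi_i,\varphi_j\}$. Assume that $\varphi_j,\varphi_{ij},\varphi^1_{ij},\varphi^2_{ij}$ are Finsler norms (continuous,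 and a norm in the second variable), and that there are $c_2\ge c_1>0$ with $c_1|\xi|\le\varphi_j(x,\xi),\varphi_{ij}(x,\xi),\varphi^1_{ij}(x,\xi)\le c_2|\xi|$ for all $x\in\overline\Omega$, $\xi\in\mathbb R^2$. For $i<j$, with $S^i$ and $S^j$ the $i$th and $j$th composites of an element of $\mathcal B^\alpha$, let $$\mathcal S^{(i,j)}(S^j,S^i)=\int_{\Omega\cap(\partial S^i\cup\partial S^j)}\psi_{i,j}\,d\mathcal H^1 ,$$ where, with $\partial^*$ the reduced boundary, $E^{(a)}$ the set of points of density $a$, and $\nu_E$ the unit normal to $\partial E$ (the measure-theoretic outer normal on $\partial^*E$, a normal to the approximate tangent line of $\partial E$ elsewhere), $\psi_{i,j}(x)$ equals - $\varphi_j(x,\nu_{S^j})$ on $\partial^*S^j\setminus\partial^*S^i$, - $\varphi^1_{ij}(x,\nu_{S^j})$ on $\partial^*S^i\cap\partial^*S^j$, - $\varphi_{ij}(x,\nu_{S^i})$ on $\partial^*S^i\setminus\partial S^j$, - $(\varphi_j+\varphi^1_{ij})(x,\nu_{S^j})$ on $\partial^*S^i\cap\partial S^j\cap (S^j)^{(1)}$,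 - $2\varphi_j(x,\nu_{S^j})$ on $\partial S^j\cap (S^j)^{(1)}\cap (S^i)^{(0)}$, - $2\varphi^2_{ij}(x,\nu_{S^j})$ on $\partial S^j\cap (S^j)^{(0)}$, - $2\varphi_{ij}(x,\nu_{S^i})$ on $(\partial S^i\setminus\partial S^j)\cap((S^i)^{(1)}\cup (S^i)^{(0)})\cap (S^j)^{(1)}$, - $\varphi^1_{ij}(x,\nu_{S^j})$ on $\partial S^i\cap\partial S^j\cap (S^i)^{(1)}$ (these regions cover the domain of integration up to an $\mathcal H^1$-null set). Finally let $\mathcal S^\alpha_s=\sum_{j=1}^\alpha\mathcal S^{(j-1,j)}(S^j,S^{j-1})$ and $\mathcal S^\alpha_t=\sum_{j=1}^\alpha\sum_{i=0}^{j-1}\mathcal S^{(i,j)}(S^j,S^i)$. **Proposition (compactness of $\mathcal B^\alpha_{\mathbf m}$).** Let $\alpha\ge1$, $\mathbf m\in\mathbb N^{\alpha+1}$, $\sigma\in\{s,t\}$, and let $\{(S^\alpha_k,\dots,S^0_k)\}_{k\in\mathbb N}\subset\mathcal B^\alpha_{\mathbf m}$ satisfy $$\sup_{k}\Big(\mathcal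 S^\alpha_\sigma(S^\alpha_k,\dots,S^0_k)+\mathcal L^2(S^\alpha_k)\Big)<\infty .$$ If $\Lambda=\infty$, assume also that the top composites have no filaments on the lateral walls, i.e. $S^\alpha_k\subset\overline{S^\alpha_k\cap\Omega}$ for every $k$. Then there are a subsequence and an element $(S^\alpha,\dots,S^0)\in\mathcal B^\alpha_{\mathbf m}$ to which the subsequence $\tau_{\mathcal B^\alpha}$-converges. -/

import Mathlib

open Set Filter Topology MeasureTheory
open scoped ENNReal

namespace Multilayer

/-- The plane `ℝ²` with its Euclidean norm. -/
abbrev Plane : Type := EuclideanSpace ℝ (Fin 2)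

/-! ### Measure-theoretic notions -/

/-- The one-dimensional Hausdorff measure `ℋ¹` of the plane. -/
noncomputable abbrev H1 : Measure Plane := Measure.hausdorffMeasure 1

/-- `B^(a)`: the points at which `B` has Lebesgue density `a`. -/
def densityPoints (B : Set Plane) (a : ℝ≥0∞) : Set Plane :=
  {x | Tendsto (fun r : ℝ => volume (B ∩ Metric.ball x r) / volume (Metric.ball x r))
    (𝓝[>] 0) (𝓝 a)}

/-- `K` has finite length, and its lower and upper one-dimensional densities are both equal to `1`
at `ℋ¹`-almost every point of `K`. Sets of length zero, such as the empty set, are included. -/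
def IsH1Rectifiable (K : Set Plane) : Prop :=
  H1 K < ⊤ ∧ ∀ᵐ x ∂(H1.restrict K),
    Tendsto (fun r : ℝ => H1 (K ∩ Metric.ball x r) / ENNReal.ofReal (2 * r)) (𝓝[>] 0) (𝓝 1)

/-- `E` has finite perimeter and its distributional derivative is `D 𝟙_E = η μ`, where `μ` is the
total variation `|D 𝟙_E|` (a finite measure) and `η` is a field of unit vectors. -/
structure IsPerimeterPair (E : Set Plane) (μ : Measure Plane) (η : Plane → Plane) : Prop where
  finite : IsFiniteMeasure μ
  measurable : Measurable η
  unit : ∀ᵐ x ∂μ, ‖η x‖ = 1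
  grad : ∀ f : Plane → ℝ, ContDiff ℝ (⊤ : ℕ∞) f → HasCompactSupport f → ∀ v : Plane,
    ∫ x in E, fderiv ℝ f x v = - ∫ x, f x * inner ℝ (η x) v ∂μ

/-- `ν = - lim_{r → 0} D 𝟙_E (B_r(x)) / |D 𝟙_E| (B_r(x))` exists and is a unit vector: `ν` is the
measure-theoretic outer unit normal to `E` at `x`. -/
def IsOuterNormal (E : Set Plane) (x ν : Plane) : Prop :=
  ‖ν‖ = 1 ∧ ∃ (μ : Measure Plane) (η : Plane → Plane), IsPerimeterPair E μ η ∧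
    Tendsto (fun r : ℝ => -((μ (Metric.ball x r)).toReal⁻¹ • ∫ y in Metric.ball x r, η y ∂μ))
      (𝓝[>] 0) (𝓝 ν)

/-- The reduced boundary `∂* E`. -/
def reducedBoundary (E : Set Plane) : Set Plane := {x | ∃ ν, IsOuterNormal E x ν}

/-- The unit vector `ν` is orthogonal to the approximate tangent line of `M` at `x`: `M` has
positive upper density at `x`, and the part of `M` near `x` that lies outside any cone around the
line `x + ν^⊥` has density zero. Such a `ν` is unique up to its sign. -/
def IsApproxNormal (M : Set Plane) (x ν : Plane) : Prop :=
  ‖ν‖ = 1 ∧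
  0 < limsup (fun r : ℝ => H1 (M ∩ Metric.ball x r) / ENNReal.ofReal (2 * r)) (𝓝[>] 0) ∧
  ∀ ε : ℝ, 0 < ε →
    Tendsto (fun r : ℝ =>
      H1 (M ∩ Metric.ball x r ∩ {y | ε * ‖y - x‖ < |inner ℝ (y - x) ν|}) / ENNReal.ofReal (2 * r))
      (𝓝[>] 0) (𝓝 0)

open Classical in
/-- The normal `ν_E` at a boundary point: the measure-theoretic outer normal on `∂* E`, and
elsewhere a unit normal to the approximate tangent line of `∂E`. For the sets considered here one
of the two exists at `ℋ¹`-almost every point of `∂E`; the value at the other points, for which some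
unit vector is taken, is immaterial. -/
noncomputable def normal (E : Set Plane) (x : Plane) : Plane :=
  if h : ∃ ν, IsOuterNormal E x ν then h.choose
  else if h' : ∃ ν, IsApproxNormal (frontier E) x ν then h'.choose
  else EuclideanSpace.single 1 1

open Classical in
/-- The signed distance from `∂E`: the distance from `E` outside `E`, and minus the distance from
the complement of `E` in `E`. -/
noncomputable def sdist (E : Set Plane) (x : Plane) : ℝ :=
  if x ∈ E then - Metric.infDist x Eᶜ else Metric.infDist x E

/-! ### Admissible composites -/

/-- `Ω = (-l, l) × (-L, ∞)`. -/
def Omega (l L : ℝ) : Set Plane := {p | -l < p 0 ∧ p 0 < l ∧ -L < p 1}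

/-- The admissible heights `h : [-l, l] → [0, Λ]` (`[0, ∞)` if `Λ = ∞`): upper semicontinuous
functions with finite pointwise variation. Only the values on `[-l, l]` matter. -/
def IsHeight (l : ℝ) (Λ : ℝ≥0∞) (h : ℝ → ℝ) : Prop :=
  (∀ x ∈ Icc (-l) l, 0 ≤ h x ∧ ENNReal.ofReal (h x) ≤ Λ) ∧
  UpperSemicontinuousOn h (Icc (-l) l) ∧ BoundedVariationOn h (Icc (-l) l)

/-- The closed subgraph `S_h` of a height. -/
def subgraph (l : ℝ) (h : ℝ → ℝ) : Set Plane := {p | -l ≤ p 0 ∧ p 0 ≤ l ∧ p 1 ≤ h (p 0)}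

/-- The admissible cracks: closed, `ℋ¹`-rectifiable subsets of `closure Ω` of finite length. -/
def IsCrack (l L : ℝ) (K : Set Plane) : Prop :=
  K ⊆ closure (Omega l L) ∧ IsClosed K ∧ IsH1Rectifiable K

/-- The admissible pairs of a height and a crack set, `K ⊆ closure (Int S_h)`. -/
def IsHeightCrack (l L : ℝ) (Λ : ℝ≥0∞) (h : ℝ → ℝ) (K : Set Plane) : Prop :=
  IsHeight l Λ h ∧ IsCrack l L K ∧ K ⊆ closure (interior (subgraph l h))

/-- The generalized subgraph `S_{h,K}` with height `h` and cracks `K`. -/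
def crackedSubgraph (l L : ℝ) (h : ℝ → ℝ) (K : Set Plane) : Set Plane :=
  (subgraph l h \ K) ∩ closure (Omega l L)

/-- The family of admissible subgraphs. -/
def admissibleSubgraphs (l L : ℝ) (Λ : ℝ≥0∞) : Set (Set Plane) :=
  {S | ∃ h K, IsHeightCrack l L Λ h K ∧ S = crackedSubgraph l L h K}

/-- `(S₁, S₀) ∈ ℬ¹`. -/
def IsTwoLayer (l L : ℝ) (Λ : ℝ≥0∞) (S₁ S₀ : Set Plane) : Prop :=
  ∃ h₁ K₁ h₀ K₀, IsHeightCrack l L Λ h₁ K₁ ∧ IsHeightCrack l L Λ h₀ K₀ ∧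
    S₁ = crackedSubgraph l L h₁ K₁ ∧ S₀ = crackedSubgraph l L h₀ K₀ ∧
    (∀ x ∈ Icc (-l) l, h₀ x ≤ h₁ x) ∧ frontier S₁ ∩ interior S₀ = ∅

/-- `ℬ^α`: tuples of composites `(S_α, …, S_0)`, with `S_i` stored at the index `i`. -/
def multilayers (l L : ℝ) (Λ : ℝ≥0∞) (α : ℕ) : Set (Fin (α + 1) → Set Plane) :=
  {S | (∀ i, S i ∈ admissibleSubgraphs l L Λ) ∧
    ∀ i : Fin α, IsTwoLayer l L Λ (S i.succ) (S i.castSucc)}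

/-- `ℬ^α_m`: the boundary of `S_i` has at most `m_i` connected components. -/
def connMultilayers (l L : ℝ) (Λ : ℝ≥0∞) (α : ℕ) (m : Fin (α + 1) → ℕ) :
    Set (Fin (α + 1) → Set Plane) :=
  {S | S ∈ multilayers l L Λ α ∧
    ∀ i, ENat.card (ConnectedComponents (frontier (S i))) ≤ (m i : ℕ∞)}

/-- `τ_{ℬ^α}`-convergence. -/
def TauConverges {α : ℕ} (S : ℕ → Fin (α + 1) → Set Plane) (T : Fin (α + 1) → Set Plane) : Prop :=
  (∀ i, (⨆ k, H1 (frontier (S k i))) < ⊤) ∧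
  ∀ i, TendstoLocallyUniformly (fun k => sdist (S k i)) (sdist (T i)) atTop

/-! ### Surface energies -/

/-- `φ¹_{ij} = min {φ_i, φ_j + φ_{ij}}`. -/
noncomputable def tension1 (φi φj φij : Plane → Plane → ℝ) (x ξ : Plane) : ℝ :=
  min (φi x ξ) (φj x ξ + φij x ξ)

/-- `φ²_{ij} = min {φ_i, φ_j}`. -/
noncomputable def tension2 (φi φj : Plane → Plane → ℝ) (x ξ : Plane) : ℝ :=
  min (φi x ξ) (φj x ξ)

open Classical in
/-- The surface tension `ψ_{ij}` of the pair of composites `(Sj, Si)`, with the normal inserted. For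
a pair in `ℬ¹` the eight regions are disjoint and cover `Ω ∩ (∂Si ∪ ∂Sj)` up to an `ℋ¹`-null set;
the last one, `∂Si ∩ ∂Sj ∩ Si^(1)`, is written as the default case. -/
noncomputable def psi (φi φj φij : Plane → Plane → ℝ) (Sj Si : Set Plane) (x : Plane) : ℝ :=
  if x ∈ reducedBoundary Sj \ reducedBoundary Si then
    φj x (normal Sj x)
  else if x ∈ reducedBoundary Si ∩ reducedBoundary Sj then
    tension1 φi φj φij x (normal Sj x)
  else if x ∈ reducedBoundary Si \ frontier Sj then
    φij x (normal Si x)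
  else if x ∈ reducedBoundary Si ∩ frontier Sj ∩ densityPoints Sj 1 then
    φj x (normal Sj x) + tension1 φi φj φij x (normal Sj x)
  else if x ∈ frontier Sj ∩ densityPoints Sj 1 ∩ densityPoints Si 0 then
    2 * φj x (normal Sj x)
  else if x ∈ frontier Sj ∩ densityPoints Sj 0 then
    2 * tension2 φi φj x (normal Sj x)
  else if x ∈ (frontier Si \ frontier Sj) ∩ (densityPoints Si 1 ∪ densityPoints Si 0) ∩
      densityPoints Sj 1 then
    2 * φij x (normal Si x)
  else
    tension1 φi φj φij x (normal Sj x)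

/-- The pairwise contribution `𝒮^{(i,j)}(Sj, Si)`, the integral of `ψ_{ij}` with respect to `ℋ¹`
over `Ω ∩ (∂Si ∪ ∂Sj)`. -/
noncomputable def pairEnergy (l L : ℝ) (φi φj φij : Plane → Plane → ℝ) (Sj Si : Set Plane) :
    ℝ≥0∞ :=
  ∫⁻ x in Omega l L ∩ (frontier Si ∪ frontier Sj), ENNReal.ofReal (psi φi φj φij Sj Si x) ∂H1

/-- `σ ∈ {s, t}`. -/
inductive Interaction where
  | sequential
  | total

/-- The `α`-layered surface energy `𝒮^α_σ`, for the tensions `φ j` of the `j`th layer with vapor and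
`φφ i j`, `i < j`, of the interface between the `i`th and the `j`th layer. -/
noncomputable def surfaceEnergy (l L : ℝ) {α : ℕ} (φ : Fin (α + 1) → Plane → Plane → ℝ)
    (φφ : Fin (α + 1) → Fin (α + 1) → Plane → Plane → ℝ) (σ : Interaction)
    (S : Fin (α + 1) → Set Plane) : ℝ≥0∞ :=
  match σ with
  | .sequential => ∑ j : Fin α,
      pairEnergy l L (φ j.castSucc) (φ j.succ) (φφ j.castSucc j.succ) (S j.succ) (S j.castSucc)
  | .total => ∑ j : Fin (α + 1), ∑ i ∈ Finset.univ.filter (fun i => i < j),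
      pairEnergy l L (φ i) (φ j) (φφ i j) (S j) (S i)

/-- `φ` is a Finsler norm on `A`: it is continuous on `A × ℝ²`, and `φ(x, ·)` is a norm for
every `x ∈ A`. -/
def IsFinslerNorm (A : Set Plane) (φ : Plane → Plane → ℝ) : Prop :=
  ContinuousOn (fun p : Plane × Plane => φ p.1 p.2) (A ×ˢ univ) ∧
  ∀ x ∈ A, (∀ ξ, 0 ≤ φ x ξ) ∧ (∀ ξ, φ x ξ = 0 → ξ = 0) ∧
    (∀ (t : ℝ) (ξ : Plane), φ x (t • ξ) = |t| * φ x ξ) ∧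
    ∀ ξ ζ, φ x (ξ + ζ) ≤ φ x ξ + φ x ζ

/-- `c₁ |ξ| ≤ φ(x, ξ) ≤ c₂ |ξ|` for all `x ∈ A` and all `ξ`. -/
def HasBounds (A : Set Plane) (c₁ c₂ : ℝ) (φ : Plane → Plane → ℝ) : Prop :=
  ∀ x ∈ A, ∀ ξ : Plane, c₁ * ‖ξ‖ ≤ φ x ξ ∧ φ x ξ ≤ c₂ * ‖ξ‖

/-- The standing assumption on the surface tensions: `φ_j`, `φ_{ij}`, `φ¹_{ij}`, `φ²_{ij}` are Finsler
norms on `closure Ω`, and the first three are uniformly comparable with the Euclidean norm. -/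
structure AdmissibleTensions (l L : ℝ) {α : ℕ} (φ : Fin (α + 1) → Plane → Plane → ℝ)
    (φφ : Fin (α + 1) → Fin (α + 1) → Plane → Plane → ℝ) : Prop where
  vapor : ∀ j, IsFinslerNorm (closure (Omega l L)) (φ j)
  interface : ∀ i j, i < j → IsFinslerNorm (closure (Omega l L)) (φφ i j)
  regime1 : ∀ i j, i < j →
    IsFinslerNorm (closure (Omega l L)) (tension1 (φ i) (φ j) (φφ i j))
  regime2 : ∀ i j, i < j → IsFinslerNorm (closure (Omega l L)) (tension2 (φ i) (φ j))
  bounds : ∃ c₁ c₂ : ℝ, 0 < c₁ ∧ c₁ ≤ c₂ ∧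
    (∀ j, HasBounds (closure (Omega l L)) c₁ c₂ (φ j)) ∧
    (∀ i j, i < j → HasBounds (closure (Omega l L)) c₁ c₂ (φφ i j) ∧
      HasBounds (closure (Omega l L)) c₁ c₂ (tension1 (φ i) (φ j) (φφ i j)))

end Multilayer

/-!
Bounded energy bounds the length of the boundaries inside `Ω`. It also bounds the heights: a height
either drops to half its value somewhere, which costs boundary length, or fills a proportional area.
So all boundaries lie in a fixed rectangle and have bounded length.

Along a subsequence the closures of the composites and the complements of their interiors have
Kuratowski limits `A` and `C`. For every `k` these two sets cover the plane; balls being connected,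
the boundaries then converge to `A ∩ C`, and the signed distances converge as well. Each boundary is
a union of at most `m_i` continua of bounded length, so by a weak form of Gołąb's theorem `A ∩ C` is
a union of at most `m_i` continua of finite length. Such a continuum is covered up to a null set by
countably many arcs, and is therefore rectifiable in the sense of densities.

The set `A` is stable under moving down, hence a subgraph, and the variation of its height is
controlled by the length of its boundary. The part of `A ∩ C` in the closure of the interior of this
subgraph is the limit crack.
-/

open scoped NNReal Finset

namespace Multilayer

/-! ### Kuratowski convergence -/

/-- Convergence of the sets `E k` to `F` along the filter `l` in the sense of Kuratowski: every
neighbourhood of a point of `F` eventually meets `E k`, and every other point has a neighbourhood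
that `E k` eventually avoids. -/
structure KuratowskiTendsto {κ X : Type*} [TopologicalSpace X] (E : κ → Set X) (l : Filter κ)
    (F : Set X) : Prop where
  eventually_nonempty : ∀ x ∈ F, ∀ U ∈ 𝓝 x, ∀ᶠ k in l, (E k ∩ U).Nonempty
  eventually_disjoint : ∀ x ∉ F, ∃ U ∈ 𝓝 x, ∀ᶠ k in l, Disjoint (E k) U

theorem exists_subseq_kuratowskiTendsto {X ι : Type*} [TopologicalSpace X]
    [SecondCountableTopology X] [Countable ι] (E : ℕ → ι → Set X) :
    ∃ (θ : ℕ → ℕ) (F : ι → Set X), StrictMono θ ∧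
      ∀ i, KuratowskiTendsto (fun k => E (θ k) i) atTop (F i) := by
  classical
  let B := TopologicalSpace.countableBasis X
  have hB : TopologicalSpace.IsTopologicalBasis B := TopologicalSpace.isBasis_countableBasis X
  have : Countable B := (TopologicalSpace.countable_countableBasis X).to_subtype
  -- The pattern of basic open sets met by `E k i` lives in a compact metrizable product of copies
  -- of `Bool`.
  let meets : ℕ → (ι × B → Bool) := fun k q => decide ((E k q.1 ∩ q.2.1).Nonempty)
  obtain ⟨g, θ, hθ, hg⟩ := CompactSpace.tendsto_subseq meets
  have hev (i : ι) (U : B) : ∀ᶠ k in atTop, ((E (θ k) i ∩ U).Nonempty ↔ g (i, U) = true) := by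
    have hiU := tendsto_pi_nhds.1 hg (i, U)
    rw [nhds_discrete, tendsto_pure] at hiU
    filter_upwards [hiU] with k hk
    rw [← hk]
    exact decide_eq_true_iff.symm
  refine ⟨θ, fun i => {x | ∀ U : B, x ∈ U.1 → g (i, U) = true}, hθ, fun i => ⟨?_, ?_⟩⟩
  · intro x hx U hU
    obtain ⟨V, hV, hxV, hVU⟩ := hB.mem_nhds_iff.1 hU
    filter_upwards [hev i ⟨V, hV⟩] with k hk
    exact (hk.2 (hx ⟨V, hV⟩ hxV)).mono (inter_subset_inter_right _ hVU)
  · intro x hx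
    simp only [mem_ofPred_eq, not_forall] at hx
    obtain ⟨U, hxU, hU⟩ := hx
    refine ⟨U, (hB.isOpen U.2).mem_nhds hxU, ?_⟩
    filter_upwards [hev i U] with k hk
    rw [disjoint_iff_inter_eq_empty, ← not_nonempty_iff_eq_empty, hk]
    exact hU

namespace KuratowskiTendsto

section Topological

variable {κ X : Type*} [TopologicalSpace X] {l : Filter κ} {E : κ → Set X} {F : Set X}

theorem comp {κ' : Type*} {l' : Filter κ'} {θ : κ' → κ} (h : KuratowskiTendsto E l F)
    (hθ : Tendsto θ l' l) : KuratowskiTendsto (E ∘ θ) l' F where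
  eventually_nonempty x hx U hU := hθ.eventually (h.eventually_nonempty x hx U hU)
  eventually_disjoint x hx :=
    (h.eventually_disjoint x hx).imp fun _ hU => ⟨hU.1, hθ.eventually hU.2⟩

theorem eventually_disjoint_of_isCompact (h : KuratowskiTendsto E l F) {Z : Set X}
    (hZ : IsCompact Z) (hd : Disjoint Z F) : ∀ᶠ k in l, Disjoint (E k) Z := by
  refine hZ.induction_on (p := fun Z => ∀ᶠ k in l, Disjoint (E k) Z) (by simp)
    (fun s t hst ht => ht.mono fun k => Disjoint.mono_right hst) ?_ fun x hx => ?_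
  · intro s t hs ht
    filter_upwards [hs, ht] with k hks hkt
    exact hks.union_right hkt
  · obtain ⟨U, hU, hev⟩ := h.eventually_disjoint x (disjoint_left.1 hd hx)
    exact ⟨U, mem_nhdsWithin_of_mem_nhds hU, hev⟩

theorem iUnion {ι : Type*} [Finite ι] {E : ι → κ → Set X} {F : ι → Set X}
    (h : ∀ i, KuratowskiTendsto (E i) l (F i)) :
    KuratowskiTendsto (fun k => ⋃ i, E i k) l (⋃ i, F i) where
  eventually_nonempty x hx U hU := by
    obtain ⟨i, hi⟩ := mem_iUnion.1 hx
    filter_upwards [(h i).eventually_nonempty x hi U hU] with k hk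
    exact hk.mono (inter_subset_inter_left _ (subset_iUnion (fun i => E i k) i))
  eventually_disjoint x hx := by
    choose U hU hev using fun i =>
      (h i).eventually_disjoint x fun hxi => hx (mem_iUnion.2 ⟨i, hxi⟩)
    refine ⟨⋂ i, U i, iInter_mem.2 hU, ?_⟩
    filter_upwards [eventually_all.2 hev] with k hk
    exact disjoint_iUnion_left.2 fun i => (hk i).mono_right (iInter_subset U i)

variable [NeBot l]

theorem mono {E' : κ → Set X} {F' : Set X} (h : KuratowskiTendsto E l F)
    (h' : KuratowskiTendsto E' l F') (hE : ∀ᶠ k in l, E k ⊆ E' k) : F ⊆ F' := by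
  intro x hx
  by_contra hxF
  obtain ⟨U, hU, hev⟩ := h'.eventually_disjoint x hxF
  obtain ⟨k, ⟨z, hz, hzU⟩, hsub, hdisj⟩ :=
    ((h.eventually_nonempty x hx U hU).and (hE.and hev)).exists
  exact disjoint_left.1 hdisj (hsub hz) hzU

theorem unique {F' : Set X} (h : KuratowskiTendsto E l F) (h' : KuratowskiTendsto E l F') :
    F = F' :=
  (h.mono h' (.of_forall fun _ => Subset.rfl)).antisymm
    (h'.mono h (.of_forall fun _ => Subset.rfl))

theorem subset (h : KuratowskiTendsto E l F) {Q : Set X} (hQ : IsClosed Q)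
    (hE : ∀ᶠ k in l, E k ⊆ Q) : F ⊆ Q := by
  intro x hx
  by_contra hxQ
  obtain ⟨k, ⟨z, hz, hzQ⟩, hsub⟩ :=
    ((h.eventually_nonempty x hx Qᶜ (hQ.isOpen_compl.mem_nhds hxQ)).and hE).exists
  exact hzQ (hsub hz)

theorem superset (h : KuratowskiTendsto E l F) {Z : Set X} (hE : ∀ᶠ k in l, Z ⊆ E k) :
    Z ⊆ F := by
  intro x hx
  by_contra hxF
  obtain ⟨U, hU, hev⟩ := h.eventually_disjoint x hxF
  obtain ⟨k, hdisj, hsub⟩ := (hev.and hE).exists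
  exact disjoint_left.1 hdisj (hsub hx) (mem_of_mem_nhds hU)

theorem isClosed (h : KuratowskiTendsto E l F) : IsClosed F := by
  rw [← isOpen_compl_iff, isOpen_iff_mem_nhds]
  intro x hx
  obtain ⟨U, hU, hE⟩ := h.eventually_disjoint x hx
  filter_upwards [eventually_mem_nhds_iff.2 hU] with y hy hyF
  obtain ⟨k, hne, hdisj⟩ := ((h.eventually_nonempty y hyF U hy).and hE).exists
  exact not_disjoint_iff_nonempty_inter.2 hne hdisj

theorem nonempty (h : KuratowskiTendsto E l F) {Q : Set X} (hQ : IsCompact Q)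
    (hE : ∀ᶠ k in l, E k ⊆ Q) (hne : ∀ᶠ k in l, (E k).Nonempty) : F.Nonempty := by
  by_contra hF
  rw [not_nonempty_iff_eq_empty] at hF
  obtain ⟨k, hdisj, hsub, z, hz⟩ :=
    ((h.eventually_disjoint_of_isCompact hQ (by simp [hF])).and (hE.and hne)).exists
  exact disjoint_left.1 hdisj hz (hsub hz)

theorem isPreconnected [T2Space X] (h : KuratowskiTendsto E l F) {Q : Set X} (hQ : IsCompact Q)
    (hE : ∀ᶠ k in l, E k ⊆ Q) (hc : ∀ᶠ k in l, IsPreconnected (E k)) : IsPreconnected F := by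
  have hF : IsCompact F := hQ.of_isClosed_subset h.isClosed (h.subset hQ.isClosed hE)
  rw [isPreconnected_iff_subset_of_fully_disjoint_closed h.isClosed]
  intro u v hu hv huv hd
  by_contra! ⟨hFu, hFv⟩
  obtain ⟨x, hxF, hxu⟩ := not_subset.1 hFu
  obtain ⟨y, hyF, hyv⟩ := not_subset.1 hFv
  have hxv : x ∈ v := (huv hxF).resolve_left hxu
  have hyu : y ∈ u := (huv hyF).resolve_right hyv
  obtain ⟨U, V, hU, hV, hFU, hFV, hUV⟩ := SeparatedNhds.of_isCompact_isCompact
    (hF.inter_right hu) (hF.inter_right hv) (hd.mono inter_subset_right inter_subset_right)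
  have hmeetV := h.eventually_nonempty x hxF V (hV.mem_nhds (hFV ⟨hxF, hxv⟩))
  have hmeetU := h.eventually_nonempty y hyF U (hU.mem_nhds (hFU ⟨hyF, hyu⟩))
  have hout := h.eventually_disjoint_of_isCompact (hQ.diff (hU.union hV)) <|
    disjoint_left.2 fun z hz hzF => hz.2 <| (huv hzF).imp
      (fun hzu => hFU ⟨hzF, hzu⟩) (fun hzv => hFV ⟨hzF, hzv⟩)
  obtain ⟨k, hkV, hkU, hkout, hkQ, hkc⟩ :=
    (hmeetV.and (hmeetU.and (hout.and (hE.and hc)))).exists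
  have hcover : E k ⊆ U ∪ V := fun z hz => by
    by_contra hzn
    exact disjoint_left.1 hkout hz ⟨hkQ hz, hzn⟩
  obtain ⟨z, -, hzU, hzV⟩ := hkc U V hU hV hcover hkU hkV
  exact disjoint_left.1 hUV hzU hzV

theorem mapsTo {Y : Type*} [TopologicalSpace Y] {E' : κ → Set Y} {F' : Set Y} {g : X → Y}
    (hg : Continuous g) (h : KuratowskiTendsto E l F) (h' : KuratowskiTendsto E' l F')
    (hE : ∀ᶠ k in l, MapsTo g (E k) (E' k)) : MapsTo g F F' := by
  intro x hx
  by_contra hxF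
  obtain ⟨U, hU, hev⟩ := h'.eventually_disjoint (g x) hxF
  obtain ⟨k, ⟨z, hz, hzU⟩, hdisj, hmaps⟩ :=
    ((h.eventually_nonempty x hx _ (hg.continuousAt hU)).and (hev.and hE)).exists
  exact disjoint_left.1 hdisj (hmaps hz) hzU

theorem union_eq_univ {E' : κ → Set X} {F' : Set X} (h : KuratowskiTendsto E l F)
    (h' : KuratowskiTendsto E' l F') (hcover : ∀ᶠ k in l, E k ∪ E' k = univ) : F ∪ F' = univ := by
  refine eq_univ_iff_forall.2 fun x => ?_
  by_contra hx
  rw [mem_union, not_or] at hx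
  obtain ⟨U, hU, hev⟩ := h.eventually_disjoint x hx.1
  obtain ⟨U', hU', hev'⟩ := h'.eventually_disjoint x hx.2
  obtain ⟨k, hk, hk', huniv⟩ := (hev.and (hev'.and hcover)).exists
  rcases (huniv ▸ mem_univ x : x ∈ E k ∪ E' k) with hxE | hxE
  · exact disjoint_left.1 hk hxE (mem_of_mem_nhds hU)
  · exact disjoint_left.1 hk' hxE (mem_of_mem_nhds hU')

end Topological

theorem tendsto_infDist {κ X : Type*} [MetricSpace X] [ProperSpace X] {l : Filter κ} [NeBot l]
    {E : κ → Set X} {F : Set X} (h : KuratowskiTendsto E l F) (hF : F.Nonempty) (x : X) :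
    Tendsto (fun k => Metric.infDist x (E k)) l (𝓝 (Metric.infDist x F)) := by
  obtain ⟨p, hp, hpd⟩ := h.isClosed.exists_infDist_eq_dist hF x
  rw [Metric.tendsto_nhds]
  intro ε hε
  have hnear := h.eventually_nonempty p hp _ (Metric.ball_mem_nhds p (half_pos hε))
  have hfar := h.eventually_disjoint_of_isCompact
    (isCompact_closedBall x (Metric.infDist x F - ε / 2)) <| disjoint_left.2 fun z hz hzF => by
      have := Metric.infDist_le_dist_of_mem (x := x) hzF
      rw [Metric.mem_closedBall, dist_comm] at hz
      linarith
  filter_upwards [hnear, hfar] with k ⟨z, hz, hzp⟩ hdisj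
  have hupper : Metric.infDist x (E k) < Metric.infDist x F + ε / 2 := by
    have := Metric.infDist_le_dist_of_mem (x := x) hz
    have := dist_triangle_right x z p
    rw [Metric.mem_ball] at hzp
    linarith
  have hlower : Metric.infDist x F - ε / 2 ≤ Metric.infDist x (E k) := by
    refine (Metric.le_infDist ⟨z, hz⟩).2 fun y hy => ?_
    by_contra! hlt
    exact disjoint_left.1 hdisj hy (Metric.mem_closedBall'.2 hlt.le)
  rw [Real.dist_eq, abs_lt]
  constructor <;> linarith

/-- Balls are connected, so a ball meeting both members of a closed cover meets their
intersection. -/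
theorem inter_of_union_eq_univ {κ X : Type*} [NormedAddCommGroup X] [NormedSpace ℝ X]
    {l : Filter κ} {A C : κ → Set X} {A' C' : Set X} (hA : KuratowskiTendsto A l A')
    (hC : KuratowskiTendsto C l C') (hAc : ∀ k, IsClosed (A k)) (hCc : ∀ k, IsClosed (C k))
    (hU : ∀ k, A k ∪ C k = univ) :
    KuratowskiTendsto (fun k => A k ∩ C k) l (A' ∩ C') where
  eventually_nonempty x hx U hxU := by
    obtain ⟨ε, hε, hεU⟩ := Metric.mem_nhds_iff.1 hxU
    filter_upwards [hA.eventually_nonempty x hx.1 _ (Metric.ball_mem_nhds x hε),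
      hC.eventually_nonempty x hx.2 _ (Metric.ball_mem_nhds x hε)] with k hkA hkC
    obtain ⟨z, hz, hz'⟩ := isPreconnected_closed_iff.1 (convex_ball x ε).isPreconnected
      (A k) (C k) (hAc k) (hCc k) (hU k ▸ subset_univ _) (by rwa [inter_comm])
      (by rwa [inter_comm])
    exact ⟨z, hz', hεU hz⟩
  eventually_disjoint x hx := by
    rcases not_and_or.1 hx with hx | hx
    · obtain ⟨U, hxU, hev⟩ := hA.eventually_disjoint x hx
      exact ⟨U, hxU, hev.mono fun k => Disjoint.mono_left inter_subset_left⟩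
    · obtain ⟨U, hxU, hev⟩ := hC.eventually_disjoint x hx
      exact ⟨U, hxU, hev.mono fun k => Disjoint.mono_left inter_subset_right⟩

end KuratowskiTendsto

theorem tendstoLocallyUniformly_of_uniformEquicontinuous {κ X Y : Type*} [UniformSpace X]
    [LocallyCompactSpace X] [UniformSpace Y] {l : Filter κ} {f : κ → X → Y} {g : X → Y}
    (hf : UniformEquicontinuous f) (h : ∀ x, Tendsto (fun k => f k x) l (𝓝 (g x))) :
    TendstoLocallyUniformly f g l := by
  rw [tendstoLocallyUniformly_iff_forall_isCompact]
  exact UniformOnFun.tendsto_iff_tendstoUniformlyOn.1 <|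
    (EquicontinuousOn.tendsto_uniformOnFun_iff_pi (𝔖 := {K | IsCompact K}) (fun _ hK => hK)
      (sUnion_eq_univ_iff.2 fun x => ⟨{x}, isCompact_singleton, rfl⟩)
      (fun _ _ => hf.equicontinuous.equicontinuousOn _) l g).2 (tendsto_pi_nhds.2 h)

/-! ### The signed distance -/

theorem sdist_eq (S : Set Plane) (x : Plane) :
    sdist S x = Metric.infDist x (closure S) - Metric.infDist x (interior S)ᶜ := by
  rw [← closure_compl, Metric.infDist_closure, Metric.infDist_closure, sdist]
  split_ifs with h
  · rw [Metric.infDist_zero_of_mem h, zero_sub]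
  · rw [Metric.infDist_zero_of_mem (show x ∈ Sᶜ from h), sub_zero]

theorem lipschitzWith_sdist (S : Set Plane) : LipschitzWith (1 + 1) (sdist S) := by
  rw [show sdist S = _ from funext (sdist_eq S)]
  exact (Metric.lipschitz_infDist_pt (closure S)).sub (Metric.lipschitz_infDist_pt (interior S)ᶜ)

/-- Kuratowski convergence of the two closed sets `closure (S k)` and `(interior (S k))ᶜ`, whose
intersection is the boundary and from which the signed distance is computed. -/
structure BoundaryTendsto {κ X : Type*} [TopologicalSpace X] (S : κ → Set X) (l : Filter κ)
    (T : Set X) : Prop where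
  closure : KuratowskiTendsto (fun k => closure (S k)) l (closure T)
  compl_interior : KuratowskiTendsto (fun k => (interior (S k))ᶜ) l (interior T)ᶜ

theorem closure_union_compl_interior {X : Type*} [TopologicalSpace X] (S : Set X) :
    closure S ∪ (interior S)ᶜ = univ :=
  eq_univ_iff_forall.2 fun _ =>
    or_iff_not_imp_right.2 fun hx => interior_subset_closure (not_not.1 hx)

theorem BoundaryTendsto.frontier {κ X : Type*} [NormedAddCommGroup X] [NormedSpace ℝ X]
    {S : κ → Set X} {l : Filter κ} {T : Set X} (h : BoundaryTendsto S l T) :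
    KuratowskiTendsto (fun k => frontier (S k)) l (frontier T) :=
  h.closure.inter_of_union_eq_univ h.compl_interior (fun _ => isClosed_closure)
    (fun _ => isOpen_interior.isClosed_compl) fun _ => closure_union_compl_interior _

theorem BoundaryTendsto.tendstoLocallyUniformly_sdist {κ : Type*} {l : Filter κ} [NeBot l]
    {S : κ → Set Plane} {T : Set Plane} (h : BoundaryTendsto S l T) (hT : T.Nonempty)
    (hT' : (interior T)ᶜ.Nonempty) :
    TendstoLocallyUniformly (fun k => sdist (S k)) (sdist T) l := by
  refine tendstoLocallyUniformly_of_uniformEquicontinuous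
    (LipschitzWith.uniformEquicontinuous _ _ fun k => lipschitzWith_sdist (S k)) fun x => ?_
  simp only [sdist_eq]
  exact (h.closure.tendsto_infDist hT.closure x).sub (h.compl_interior.tendsto_infDist hT' x)

/-! ### The length of a connected set -/

section Length

open Metric

variable {X : Type*} [MetricSpace X] [MeasurableSpace X] [BorelSpace X] {E : Set X}

theorem ofReal_le_hausdorffMeasure_inter_ball (hE : IsPreconnected E) {x y : X} (hx : x ∈ E)
    (hy : y ∈ E) {r : ℝ} (hr : r ≤ dist x y) : ENNReal.ofReal r ≤ μH[1] (E ∩ ball x r) := by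
  have hsub : Ico 0 r ⊆ dist x '' (E ∩ ball x r) := by
    intro t ht
    obtain ⟨z, hz, rfl⟩ := hE.intermediate_value hx hy (f := dist x) (by fun_prop)
      ⟨(dist_self x).le.trans ht.1, ht.2.le.trans hr⟩
    exact ⟨z, ⟨hz, mem_ball'.2 ht.2⟩, rfl⟩
  calc ENNReal.ofReal r = μH[1] (Ico (0 : ℝ) r) := by
        rw [hausdorffMeasure_real, Real.volume_Ico, sub_zero]
    _ ≤ μH[1] (dist x '' (E ∩ ball x r)) := measure_mono hsub
    _ ≤ μH[1] (E ∩ ball x r) := by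
        simpa using (LipschitzWith.dist_right x).hausdorffMeasure_image_le zero_le_one
          (E ∩ ball x r)

theorem encard_mul_le_hausdorffMeasure (hE : IsPreconnected E) {s : Set X} (hs : s ⊆ E) {δ : ℝ≥0}
    (hsep : IsSeparated δ s) (hδ : δ < ediam E) : s.encard * (δ / 2 : ℝ≥0∞) ≤ μH[1] E := by
  have hball (z : s) : (δ / 2 : ℝ≥0∞) ≤ (μH[1]).restrict E (ball z (δ / 2)) := by
    obtain ⟨y, hy, hzy⟩ : ∃ y ∈ E, (δ / 2 : ℝ) ≤ dist z.1 y := by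
      by_contra! hcon
      refine hδ.not_ge (ediam_le fun a ha b hb => ?_)
      have hab : dist a b ≤ δ := by linarith [dist_triangle_left a b z, hcon a ha, hcon b hb]
      rw [edist_nndist]
      exact_mod_cast hab
    rw [Measure.restrict_apply isOpen_ball.measurableSet, inter_comm]
    convert ofReal_le_hausdorffMeasure_inter_ball hE (hs z.2) hy hzy
    simp [ENNReal.ofReal_div_of_pos]
  have hdisj : Pairwise (Function.onFun Disjoint fun z : s => ball (z : X) (δ / 2)) := by
    intro z w hzw
    refine ball_disjoint_ball ?_
    have hsep' : (δ : ℝ≥0∞) < edist z.1 w.1 := hsep z.2 w.2 (Subtype.coe_ne_coe.2 hzw)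
    rw [edist_nndist, ENNReal.coe_lt_coe, ← NNReal.coe_lt_coe, coe_nndist] at hsep'
    linarith
  calc s.encard * (δ / 2 : ℝ≥0∞) = ∑' _ : s, (δ / 2 : ℝ≥0∞) := (ENNReal.tsum_set_const s _).symm
    _ ≤ ∑' z : s, (μH[1]).restrict E (ball z (δ / 2)) := ENNReal.tsum_le_tsum hball
    _ ≤ (μH[1]).restrict E (⋃ z : s, ball z (δ / 2)) :=
        tsum_meas_le_meas_iUnion_of_disjoint _ (fun _ => isOpen_ball.measurableSet) hdisj
    _ ≤ μH[1] E := (measure_mono (subset_univ _)).trans_eq (Measure.restrict_apply_univ E)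

theorem packingNumber_mul_le_hausdorffMeasure (hE : IsPreconnected E) {δ : ℝ≥0}
    (hδ : δ < ediam E) : packingNumber δ E * (δ / 2 : ℝ≥0∞) ≤ μH[1] E := by
  simp only [packingNumber, ENat.toENNReal_iSup, ENNReal.iSup_mul]
  exact iSup_le fun s => iSup_le fun hs => iSup_le fun hsep =>
    encard_mul_le_hausdorffMeasure hE hs hsep hδ

theorem hausdorffMeasure_le_of_coveringNumber_mul_le {F : Set X} {d : ℝ} (hd : 0 ≤ d) {C : ℝ≥0∞}
    (h : ∀ᶠ δ : ℝ≥0 in 𝓝[>] 0, coveringNumber δ F * (2 * δ : ℝ≥0∞) ^ d ≤ C) : μH[d] F ≤ C := by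
  rcases eq_or_ne C ⊤ with rfl | hC
  · exact le_top
  have hcover : ∀ᶠ δ : ℝ≥0 in 𝓝[>] 0, coveringNumber δ F ≠ ⊤ := by
    filter_upwards [h, self_mem_nhdsWithin] with δ hδ hpos htop
    have hne : (2 * δ : ℝ≥0∞) ^ d ≠ 0 :=
      (ENNReal.rpow_pos (by simpa using hpos) (by finiteness)).ne'
    rw [htop, ENat.toENNReal_top, ENNReal.top_mul hne] at hδ
    exact hC (top_le_iff.1 hδ)
  have hlim : Tendsto (fun δ : ℝ≥0 => (2 * δ : ℝ≥0∞)) (𝓝[>] 0) (𝓝 0) := by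
    have : Continuous fun δ : ℝ≥0 => ((2 * δ : ℝ≥0) : ℝ≥0∞) := by fun_prop
    simpa using (this.tendsto 0).mono_left nhdsWithin_le_nhds
  have (δ : ℝ≥0) : Countable (minimalCover δ F) := finite_minimalCover.countable.to_subtype
  refine (Measure.hausdorffMeasure_le_liminf_tsum d F _ hlim
    (fun δ (z : minimalCover δ F) => closedEBall (z : X) δ)
    (.of_forall fun δ z => ediam_closedEBall_le) ?_).trans
    (liminf_le_of_frequently_le' (Eventually.frequently ?_))
  · filter_upwards [hcover] with δ hδ
    simpa only [iUnion_coe_set] using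
      isCover_iff_subset_iUnion_closedEBall.1 (isCover_minimalCover hδ)
  · filter_upwards [h, hcover] with δ hδ hδ'
    calc ∑' z : minimalCover δ F, ediam (closedEBall (z : X) δ) ^ d
        ≤ ∑' _ : minimalCover δ F, (2 * δ : ℝ≥0∞) ^ d :=
          ENNReal.tsum_le_tsum fun z => ENNReal.rpow_le_rpow ediam_closedEBall_le hd
      _ = coveringNumber δ F * (2 * δ : ℝ≥0∞) ^ d := by
          rw [ENNReal.tsum_set_const, encard_minimalCover hδ']
      _ ≤ C := hδ

end Length

namespace KuratowskiTendsto

open Metric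

section PseudoEMetric

variable {κ X : Type*} [PseudoEMetricSpace X] {l : Filter κ} {E : κ → Set X} {F : Set X}

theorem eventually_encard_le_packingNumber (h : KuratowskiTendsto E l F) {s : Set X}
    (hs : s.Finite) (hsF : s ⊆ F) {δ : ℝ≥0} (hsep : IsSeparated δ s) :
    ∀ᶠ k in l, s.encard ≤ packingNumber δ (E k) := by
  have := hs.to_subtype
  have hopen : IsOpen {w : s → X | ∀ a b, a ≠ b → δ < edist (w a) (w b)} := by
    simp only [ofPred_forall]
    exact isOpen_iInter_of_finite fun a => isOpen_iInter_of_finite fun b =>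
      isOpen_iInter_of_finite fun _ => isOpen_lt continuous_const (by fun_prop)
  have hmem := hopen.mem_nhds (x := Subtype.val) fun a b hab =>
    hsep a.2 b.2 (Subtype.coe_ne_coe.2 hab)
  rw [nhds_pi, Filter.mem_pi] at hmem
  obtain ⟨I, -, U, hU, hsub⟩ := hmem
  filter_upwards [eventually_all.2 fun a : s => h.eventually_nonempty a (hsF a.2) (U a) (hU a)]
    with k hk
  choose w hwE hwU using hk
  have hw : ∀ a b, a ≠ b → δ < edist (w a) (w b) := hsub fun a _ => hwU a
  have hinj : Function.Injective w := fun a b hab => by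
    by_contra hne
    simpa [hab] using hw a b hne
  calc s.encard = (range w).encard := by rw [← image_univ, hinj.encard_image, encard_univ]; rfl
    _ ≤ packingNumber δ (E k) := by
        refine IsSeparated.encard_le_packingNumber (range_subset_iff.2 hwE) ?_
        rintro _ ⟨a, rfl⟩ _ ⟨b, rfl⟩ hab
        exact hw a b fun h => hab (h ▸ rfl)

theorem packingNumber_le (h : KuratowskiTendsto E l F) {δ : ℝ≥0} {N : ℕ∞}
    (hN : ∃ᶠ k in l, packingNumber δ (E k) ≤ N) : packingNumber δ F ≤ N := by
  refine iSup_le fun s => iSup₂_le fun hsF hsep => ?_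
  by_contra! hlt
  have hNtop : N ≠ ⊤ := hlt.ne_top
  obtain ⟨t, hts, ht⟩ := exists_subset_encard_eq (Order.add_one_le_of_lt hlt)
  have htfin : t.Finite := by
    rw [← encard_ne_top_iff, ht]
    exact WithTop.add_ne_top.2 ⟨hNtop, ENat.one_ne_top⟩
  obtain ⟨k, hkN, hk⟩ := (hN.and_eventually
    (h.eventually_encard_le_packingNumber htfin (hts.trans hsF) (hsep.subset hts))).exists
  exact (ENat.lt_add_one_iff hNtop).2 le_rfl |>.not_ge (ht ▸ hk.trans hkN)

theorem eventually_lt_ediam (h : KuratowskiTendsto E l F) {δ : ℝ≥0∞} (hδ : δ < ediam F) :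
    ∀ᶠ k in l, δ < ediam (E k) := by
  obtain ⟨p, hp, q, hq, hpq⟩ : ∃ p ∈ F, ∃ q ∈ F, δ < edist p q := by
    by_contra! hcon
    exact hδ.not_ge (ediam_le hcon)
  have hopen : IsOpen {z : X × X | δ < edist z.1 z.2} := isOpen_lt continuous_const (by fun_prop)
  obtain ⟨U, hU, V, hV, hUV⟩ := mem_nhds_prod_iff.1 (hopen.mem_nhds (x := (p, q)) hpq)
  filter_upwards [h.eventually_nonempty p hp U hU, h.eventually_nonempty q hq V hV]
    with k ⟨a, ha, haU⟩ ⟨b, hb, hbV⟩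
  exact (hUV (mk_mem_prod haU hbV)).trans_le (edist_le_ediam_of_mem ha hb)

end PseudoEMetric

/-- By Gołąb's theorem the constant `4` can be replaced by `1`. -/
theorem hausdorffMeasure_le {κ X : Type*} [MetricSpace X] [MeasurableSpace X] [BorelSpace X]
    {l : Filter κ} [NeBot l] {E : κ → Set X} {F : Set X} (h : KuratowskiTendsto E l F) {M : ℝ≥0∞}
    (hc : ∀ᶠ k in l, IsPreconnected (E k)) (hE : ∀ᶠ k in l, μH[1] (E k) ≤ M) :
    μH[1] F ≤ 4 * M := by
  rcases F.subsingleton_or_nontrivial with hF | hF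
  · have := Measure.nullSingletonClass_hausdorff X one_pos
    rw [hF.measure_zero]
    exact zero_le
  refine hausdorffMeasure_le_of_coveringNumber_mul_le zero_le_one ?_
  have hsmall : ∀ᶠ δ : ℝ≥0 in 𝓝[>] 0, (δ : ℝ≥0∞) < ediam F :=
    nhdsWithin_le_nhds <| (ENNReal.continuous_coe.tendsto 0).eventually_lt_const
      (by simpa [pos_iff_ne_zero, ediam_eq_zero_iff] using hF)
  filter_upwards [hsmall, self_mem_nhdsWithin] with δ hδ hpos
  have hne : (δ / 2 : ℝ≥0∞) ≠ 0 := by simpa using (show 0 < δ from hpos).ne'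
  have hpack : packingNumber δ F ≤ ENat.floor (M / (δ / 2)) := by
    refine h.packingNumber_le (Eventually.frequently ?_)
    filter_upwards [hc, hE, h.eventually_lt_ediam hδ] with k hkc hkE hkδ
    rw [ENat.le_floor, ENNReal.le_div_iff_mul_le (.inl hne) (.inl (by finiteness))]
    exact (packingNumber_mul_le_hausdorffMeasure hkc hkδ).trans hkE
  rw [ENat.le_floor, ENNReal.le_div_iff_mul_le (.inl hne) (.inl (by finiteness))] at hpack
  calc coveringNumber δ F * (2 * δ : ℝ≥0∞) ^ (1 : ℝ)
      ≤ packingNumber δ F * (2 * δ : ℝ≥0∞) := by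
        rw [ENNReal.rpow_one]
        gcongr
        exact coveringNumber_le_packingNumber δ F
    _ = 4 * (packingNumber δ F * (δ / 2)) := by
        rw [show (4 : ℝ≥0∞) = 2 * 2 by norm_num, mul_left_comm (2 * 2), mul_assoc,
          ENNReal.mul_div_cancel two_ne_zero (by simp)]
    _ ≤ 4 * M := by gcongr

end KuratowskiTendsto

/-! ### Arcs in continua of finite length -/

/-- `f` is a path from `x` to `y` in `E`, parametrized by `[0, 1]`, with Lipschitz constant `C` up
to the additive error `ε`. The values of `f` off `[0, 1]` are irrelevant. -/
structure IsApproxLipschitzPath {X : Type*} [MetricSpace X] (E : Set X) (x y : X) (C ε : ℝ)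
    (f : ℝ → X) : Prop where
  source : f 0 = x
  target : f 1 = y
  mem : ∀ t, f t ∈ E
  dist_le : ∀ ⦃s t⦄, 0 ≤ s → s ≤ t → t ≤ 1 → dist (f s) (f t) ≤ C * (t - s) + ε

namespace IsApproxLipschitzPath

variable {X : Type*} [MetricSpace X] {E : Set X} {x y : X} {C ε : ℝ} {f : ℝ → X}

theorem of_le_add (h : IsApproxLipschitzPath E x y C ε f) {C' ε' a : ℝ} (ha : 0 ≤ a)
    (hC : C ≤ C' + a) (hε : ε + a ≤ ε') : IsApproxLipschitzPath E x y C' ε' f where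
  source := h.source
  target := h.target
  mem := h.mem
  dist_le s t hs hst ht :=
    calc dist (f s) (f t) ≤ C * (t - s) + ε := h.dist_le hs hst ht
      _ ≤ (C' + a) * (t - s) + ε := by gcongr
      _ ≤ C' * (t - s) + ε' := by nlinarith

theorem exists_of_forall_pos (hE : IsCompact E)
    (h : ∀ ε > 0, ∃ f, IsApproxLipschitzPath E x y C ε f) :
    ∃ f, IsApproxLipschitzPath E x y C 0 f := by
  choose f hf using fun n : ℕ => h (1 / ((n : ℝ) + 1)) (by positivity)
  let u : Ultrafilter ℕ := hyperfilter ℕ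
  have hlim (t : ℝ) : ∃ z ∈ E, Tendsto (fun n => f n t) u (𝓝 z) :=
    hE.ultrafilter_le_nhds (u.map fun n => f n t)
      (le_principal_iff.2
        (univ_mem' fun n => (hf n).mem t : (fun n => f n t) ⁻¹' E ∈ (u : Filter ℕ)))
  choose g hgE hg using hlim
  refine ⟨g, ?_, ?_, hgE, fun s t hs hst ht => ?_⟩
  · exact tendsto_nhds_unique (hg 0) (by simp only [(hf _).source, tendsto_const_nhds])
  · exact tendsto_nhds_unique (hg 1) (by simp only [(hf _).target, tendsto_const_nhds])
  · have hε : Tendsto (fun n : ℕ => C * (t - s) + 1 / ((n : ℝ) + 1)) u (𝓝 (C * (t - s) + 0)) :=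
      tendsto_const_nhds.add
        (tendsto_one_div_add_atTop_nhds_zero_nat.mono_left Nat.hyperfilter_le_atTop)
    exact le_of_tendsto_of_tendsto' ((hg s).dist (hg t)) hε fun n => (hf n).dist_le hs hst ht

theorem of_chain {g : ℕ → X} {n : ℕ} {c : ℝ} (hc : 0 ≤ c) (h0 : g 0 = x) (hn : g n = y)
    (hgE : ∀ i, g i ∈ E) (hg : ∀ i, dist (g i) (g (i + 1)) ≤ c) :
    IsApproxLipschitzPath E x y (n * c) c fun t => g ⌊t * n⌋₊ where
  source := by simpa using h0
  target := by simpa using hn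
  mem t := hgE _
  dist_le s t hs hst _ := by
    have hfloor : ⌊s * n⌋₊ ≤ ⌊t * n⌋₊ := by gcongr
    calc dist (g ⌊s * n⌋₊) (g ⌊t * n⌋₊) ≤ ∑ _i ∈ Finset.Ico ⌊s * n⌋₊ ⌊t * n⌋₊, c :=
          dist_le_Ico_sum_of_dist_le hfloor fun _ _ => hg _
      _ = ((⌊t * n⌋₊ : ℝ) - ⌊s * n⌋₊) * c := by
          rw [Finset.sum_const, Nat.card_Ico, nsmul_eq_mul, Nat.cast_sub hfloor]
      _ ≤ (t * n - (s * n - 1)) * c := by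
          gcongr
          · exact Nat.floor_le (mul_nonneg (hs.trans hst) n.cast_nonneg)
          · exact (Nat.sub_one_lt_floor _).le
      _ = n * c * (t - s) + c := by ring

theorem continuousOn (h : IsApproxLipschitzPath E x y C 0 f) : ContinuousOn f (Icc 0 1) := by
  refine (LipschitzOnWith.of_dist_le' (K := C) fun s hs t ht => ?_).continuousOn
  rcases le_total s t with hst | hst
  · rw [dist_comm s, Real.dist_eq, abs_of_nonneg (sub_nonneg.2 hst)]
    simpa using h.dist_le hs.1 hst ht.2
  · rw [dist_comm, Real.dist_eq, abs_of_nonneg (sub_nonneg.2 hst)]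
    simpa using h.dist_le ht.1 hst hs.2

theorem exists_cut (h : IsApproxLipschitzPath E x y C 0 f) {s t : ℝ} (hs : 0 ≤ s) (hst : s < t)
    (ht : t ≤ 1) (heq : f s = f t) :
    ∃ g, IsApproxLipschitzPath E x y (C * (1 - (t - s))) 0 g := by
  let skip : ℝ → ℝ := fun a => if a ≤ s then a else a + (t - s)
  have hskip {a b : ℝ} (ha : 0 ≤ a) (hab : a ≤ b) (hb : b ≤ 1 - (t - s)) :
      dist (f (skip a)) (f (skip b)) ≤ C * (b - a) := by
    simp only [skip]
    split_ifs with has hbs hbs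
    · linarith [h.dist_le ha hab (by linarith)]
    · have hleft := h.dist_le ha has (by linarith)
      have hright := h.dist_le (s := t) (t := b + (t - s)) (by linarith) (by linarith) (by linarith)
      have := dist_triangle (f a) (f s) (f (b + (t - s)))
      rw [← heq] at hright
      linarith
    · linarith
    · linarith [h.dist_le (s := a + (t - s)) (t := b + (t - s)) (by linarith) (by linarith)
        (by linarith)]
  refine ⟨fun a => f (skip (a * (1 - (t - s)))), ?_, ?_, fun _ => h.mem _, fun a b ha hab hb => ?_⟩
  · simp only [zero_mul, skip, if_pos hs, h.source]
  · simp only [one_mul, skip]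
    split_ifs with hle
    · obtain rfl : t = 1 := by linarith
      rw [sub_sub_cancel, heq, h.target]
    · rw [sub_add_cancel, h.target]
  · have hq : 0 ≤ 1 - (t - s) := by linarith
    calc dist (f (skip (a * (1 - (t - s))))) (f (skip (b * (1 - (t - s)))))
        ≤ C * (b * (1 - (t - s)) - a * (1 - (t - s))) :=
          hskip (by positivity) (by gcongr) (mul_le_of_le_one_left hq hb)
      _ = C * (1 - (t - s)) * (b - a) + 0 := by ring

/-- A path with the least possible Lipschitz constant is injective, since a loop could be cut
off. -/
theorem exists_injOn (hE : IsCompact E) (hxy : x ≠ y)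
    (h : ∃ C f, IsApproxLipschitzPath E x y C 0 f) :
    ∃ C f, IsApproxLipschitzPath E x y C 0 f ∧ InjOn f (Icc 0 1) := by
  let P : Set ℝ := {C | ∃ f, IsApproxLipschitzPath E x y C 0 f}
  have hdist {C : ℝ} (hC : C ∈ P) : dist x y ≤ C := by
    obtain ⟨f, hf⟩ := hC
    simpa [hf.source, hf.target] using hf.dist_le le_rfl zero_le_one le_rfl
  have hP : BddBelow P := ⟨dist x y, fun _ => hdist⟩
  obtain ⟨f, hf⟩ : sInf P ∈ P := exists_of_forall_pos hE fun ε hε => by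
    obtain ⟨C, ⟨f, hf⟩, hC⟩ := exists_lt_of_csInf_lt h (lt_add_of_pos_right (sInf P) hε)
    exact ⟨f, hf.of_le_add hε.le hC.le (by simp)⟩
  refine ⟨_, f, hf, fun s hs t ht heq => ?_⟩
  by_contra hne
  wlog hst : s < t generalizing s t
  · exact this t ht s hs heq.symm (Ne.symm hne) (lt_of_le_of_ne (not_lt.1 hst) (Ne.symm hne))
  have hcut : sInf P ≤ sInf P * (1 - (t - s)) :=
    csInf_le hP (hf.exists_cut hs.1 hst ht.2 heq)
  have hpos : 0 < sInf P := (dist_pos.2 hxy).trans_le (hdist ⟨f, hf⟩)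
  nlinarith

end IsApproxLipschitzPath

section Arc

open Metric

variable {X : Type*} [MetricSpace X] {E : Set X} {x y : X}

theorem exists_chain (hE : IsPreconnected E) {δ : ℝ≥0} (hδ : 0 < δ) {s : Set X} (hs : s.Finite)
    (hsE : s ⊆ E) (hcover : IsCover δ E s) (hx : x ∈ s) (hy : y ∈ s) :
    ∃ (n : ℕ) (g : ℕ → X), n < s.encard ∧ g 0 = x ∧ g n = y ∧ (∀ i, g i ∈ E) ∧
      ∀ i, dist (g i) (g (i + 1)) ≤ 3 * δ := by
  have := hs.fintype
  let G : SimpleGraph s := .fromRel fun a b => dist a b ≤ 3 * δ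
  have hG {a b : s} (h : dist a b ≤ 3 * δ) : G.Reachable a b := by
    rcases eq_or_ne a b with rfl | hab
    · exact .refl _
    · exact SimpleGraph.Adj.reachable ⟨hab, .inl h⟩
  have hnet {z : X} (hz : z ∈ E) : ∃ a : s, dist z a ≤ δ := by
    simpa using isCover_iff_subset_iUnion_closedBall.1 hcover hz
  have hreach : G.Reachable ⟨x, hx⟩ ⟨y, hy⟩ := by
    refine hE.induction₂' (fun z w => ∀ a b : s, dist z a ≤ δ → dist w b ≤ δ → G.Reachable a b)
      (fun z _ => ?_) (fun z₁ z₂ z₃ _ hz₂ _ h h' a b ha hb => ?_) (hsE hx) (hsE hy) _ _ (by simp)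
      (by simp)
    · filter_upwards [nhdsWithin_le_nhds (ball_mem_nhds z (show (0 : ℝ) < δ from hδ))] with w hw
      rw [mem_ball] at hw
      have hnear {a b : s} (ha : dist z a ≤ δ) (hb : dist w b ≤ δ) : dist a b ≤ 3 * δ := by
        rw [Subtype.dist_eq]
        linarith [dist_triangle4 (a : X) z w b, dist_comm (a : X) z, dist_comm z w]
      exact ⟨fun a b ha hb => hG (hnear ha hb), fun a b ha hb => (hG (hnear hb ha)).symm⟩
    · obtain ⟨c, hc⟩ := hnet hz₂
      exact (h a c ha hc).trans (h' c b hc hb)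
  obtain ⟨w, hw⟩ := hreach.exists_isPath
  refine ⟨w.length, fun i => w.getVert i, ?_, by simp, by simp, fun i => hsE (w.getVert i).2,
    fun i => ?_⟩
  · rw [← coe_fintypeCard]
    exact_mod_cast hw.length_lt
  · rcases lt_or_ge i w.length with hi | hi
    · rcases (w.adj_getVert_succ hi).2 with h | h
      · exact h
      · rw [dist_comm]
        exact h
    · beta_reduce
      rw [w.getVert_of_length_le hi, w.getVert_of_length_le (by lia), dist_self]
      positivity

variable [MeasurableSpace X] [BorelSpace X]

theorem exists_isApproxLipschitzPath (hc : IsPreconnected E) (hfin : μH[1] E ≠ ⊤) (hx : x ∈ E)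
    (hy : y ∈ E) (hxy : x ≠ y) {ε : ℝ} (hε : 0 < ε) :
    ∃ f, IsApproxLipschitzPath E x y (6 * (μH[1] E).toReal) ε f := by
  obtain ⟨δ, hδ, hδε, hδd⟩ : ∃ δ : ℝ≥0, 0 < δ ∧ 6 * δ ≤ ε ∧ δ < dist x y := by
    have hm : 0 < min (ε / 6) (dist x y / 2) := by have := dist_pos.2 hxy; positivity
    refine ⟨_, Real.toNNReal_pos.2 hm, ?_, ?_⟩ <;> rw [Real.coe_toNNReal _ hm.le]
    · linarith [min_le_left (ε / 6) (dist x y / 2)]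
    · linarith [min_le_right (ε / 6) (dist x y / 2), dist_pos.2 hxy]
  have hediam : δ < ediam E :=
    lt_of_lt_of_le (by rw [edist_nndist]; exact_mod_cast hδd) (edist_le_ediam_of_mem hx hy)
  have hcovering : coveringNumber δ E * (δ / 2 : ℝ≥0∞) ≤ μH[1] E :=
    le_trans (by gcongr; exact coveringNumber_le_packingNumber δ E)
      (packingNumber_mul_le_hausdorffMeasure hc hediam)
  have hfinite : coveringNumber δ E ≠ ⊤ := fun htop => by
    rw [htop, ENat.toENNReal_top, ENNReal.top_mul (by simpa using hδ.ne')] at hcovering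
    exact hfin (top_le_iff.1 hcovering)
  obtain ⟨n, g, hn, h0, hgn, hgE, hg⟩ := exists_chain hc hδ
    (s := insert x (insert y (minimalCover δ E))) ((finite_minimalCover.insert _).insert _)
    (insert_subset hx (insert_subset hy minimalCover_subset))
    ((isCover_minimalCover hfinite).mono (by grind)) (mem_insert _ _)
    (mem_insert_of_mem _ (mem_insert _ _))
  have hcard : n < coveringNumber δ E + 1 + 1 := hn.trans_le <| by
    rw [← encard_minimalCover hfinite]
    exact (encard_insert_le _ _).trans (by gcongr; exact encard_insert_le _ _)
  lift coveringNumber δ E to ℕ using hfinite with N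
  have hN : (N : ℝ) * (δ / 2) ≤ (μH[1] E).toReal := by
    simpa using ENNReal.toReal_mono hfin hcovering
  have hnN : (n : ℝ) ≤ N + 1 := by exact_mod_cast Nat.lt_succ_iff.1 (by exact_mod_cast hcard)
  refine ⟨_, (IsApproxLipschitzPath.of_chain (by positivity) h0 hgn hgE hg).of_le_add
    (a := 3 * δ) (by positivity) ?_ (by linarith)⟩
  calc (n : ℝ) * (3 * δ) ≤ (N + 1) * (3 * δ) := by gcongr
    _ = 6 * (N * (δ / 2)) + 3 * δ := by ring
    _ ≤ 6 * (μH[1] E).toReal + 3 * δ := by gcongr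

theorem exists_arc (hE : IsCompact E) (hc : IsPreconnected E) (hfin : μH[1] E ≠ ⊤) (hx : x ∈ E)
    (hy : y ∈ E) (hxy : x ≠ y) :
    ∃ f : ℝ → X, f 0 = x ∧ f 1 = y ∧ (∀ t, f t ∈ E) ∧ ContinuousOn f (Icc 0 1) ∧
      InjOn f (Icc 0 1) := by
  obtain ⟨C, f, hf, hinj⟩ := IsApproxLipschitzPath.exists_injOn hE hxy
    ⟨_, IsApproxLipschitzPath.exists_of_forall_pos hE fun _ hε =>
      exists_isApproxLipschitzPath hc hfin hx hy hxy hε⟩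
  exact ⟨f, hf.source, hf.target, hf.mem, hf.continuousOn, hinj⟩

end Arc

/-! ### Densities and rectifiability -/

section Density

open Metric

theorem tendsto_measure_ball_div {X : Type*} [PseudoMetricSpace X] [MeasurableSpace X]
    {ν : Measure X} {x : X} {θ : ℝ≥0∞}
    (h : Tendsto (fun r : ℝ => ν (closedBall x r) / ENNReal.ofReal (2 * r)) (𝓝[>] 0) (𝓝 θ)) :
    Tendsto (fun r : ℝ => ν (ball x r) / ENNReal.ofReal (2 * r)) (𝓝[>] 0) (𝓝 θ) := by
  refine tendsto_order.2 ⟨fun a ha => ?_, fun a ha => ?_⟩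
  · have hlim : Tendsto (fun c : ℝ => ENNReal.ofReal c * θ) (𝓝[<] 1) (𝓝 θ) := by
      have : Tendsto ENNReal.ofReal (𝓝[<] 1) (𝓝 1) := by
        simpa using (ENNReal.tendsto_ofReal (tendsto_id (x := 𝓝 (1 : ℝ)))).mono_left
          nhdsWithin_le_nhds
      simpa using ENNReal.Tendsto.mul_const this (.inl one_ne_zero)
    obtain ⟨c, hac, hc0, hc1⟩ :=
      ((hlim.eventually_const_lt ha).and (Ioo_mem_nhdsLT zero_lt_one)).exists
    have hscale : Tendsto (fun r : ℝ => c * r) (𝓝[>] 0) (𝓝[>] 0) := by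
      refine tendsto_nhdsWithin_iff.2 ⟨?_, ?_⟩
      · simpa using (tendsto_id.const_mul c).mono_left (nhdsWithin_le_nhds (a := (0 : ℝ)))
      · filter_upwards [self_mem_nhdsWithin] with r hr using mul_pos hc0 hr
    have hlower := ENNReal.Tendsto.const_mul (a := ENNReal.ofReal c) (h.comp hscale)
      (.inr ENNReal.ofReal_ne_top)
    filter_upwards [hlower.eventually_const_lt hac, self_mem_nhdsWithin] with r hlt hr
    rw [mem_Ioi] at hr
    refine hlt.trans_le ?_
    rw [Function.comp_apply, mul_left_comm, ENNReal.ofReal_mul hc0.le, ← mul_div_assoc,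
      ENNReal.mul_div_mul_left _ _ (ENNReal.ofReal_pos.2 hc0).ne' ENNReal.ofReal_ne_top]
    gcongr
    exact closedBall_subset_ball (mul_lt_of_lt_one_left hr hc1)
  · filter_upwards [h.eventually_lt_const ha] with r hr
    refine lt_of_le_of_lt ?_ hr
    gcongr
    exact ball_subset_closedBall

variable {X : Type*} [MetricSpace X] [SecondCountableTopology X] [MeasurableSpace X] [BorelSpace X]
  [HasBesicovitchCovering X]

theorem exists_countable_ae_cover_tsum_ediam_rpow_le (μ : Measure X) [IsFiniteMeasure μ] {d : ℝ}
    (hd : 0 ≤ d) {c : ℝ≥0} (hc : c ≠ 0) {s U : Set X} (hU : IsOpen U) (hsU : s ⊆ U)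
    (hs : ∀ x ∈ s, ∃ᶠ r in 𝓝[>] (0 : ℝ), c * ENNReal.ofReal (2 * r) ^ d < μ (closedBall x r))
    {δ : ℝ} (hδ : 0 < δ) :
    ∃ (T : Set X) (B : T → Set X), T.Countable ∧ (∀ x, ediam (B x) ≤ ENNReal.ofReal (2 * δ)) ∧
      μ (s \ ⋃ x, B x) = 0 ∧ ∑' x, ediam (B x) ^ d ≤ (c : ℝ≥0∞)⁻¹ * μ U := by
  have hball (x : X) : ∃ R > 0, x ∈ s → closedBall x R ⊆ U := by
    by_cases hx : x ∈ s
    · obtain ⟨R, hR, h⟩ := nhds_basis_closedBall.mem_iff.1 (hU.mem_nhds (hsU hx))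
      exact ⟨R, hR, fun _ => h⟩
    · exact ⟨1, one_pos, fun h => absurd h hx⟩
  choose R hR hRU using hball
  obtain ⟨T, r, hT, hTs, hr, hcover, hdisj⟩ := Besicovitch.exists_disjoint_closedBall_covering_ae
    μ (fun x => {r | c * ENNReal.ofReal (2 * r) ^ d < μ (closedBall x r)}) s
    (fun x hx ε hε => ((hs x hx).and_eventually (Ioo_mem_nhdsGT hε)).exists)
    (fun x => min (R x) δ) fun x _ => lt_min (hR x) hδ
  have hdiam (x : T) : ediam (closedBall x.1 (r x)) ≤ ENNReal.ofReal (2 * r x) := by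
    rw [← closedEBall_ofReal (hr x x.2).2.1.le, ENNReal.ofReal_mul zero_le_two,
      ENNReal.ofReal_ofNat]
    exact ediam_closedEBall_le
  refine ⟨T, fun x => closedBall x.1 (r x), hT, fun x => (hdiam x).trans ?_, ?_, ?_⟩
  · gcongr
    exact (hr x x.2).2.2.le.trans (min_le_right _ _)
  · rwa [iUnion_coe_set T fun x => closedBall x.1 (r x)]
  · calc ∑' x : T, ediam (closedBall x.1 (r x)) ^ d
        ≤ ∑' x : T, (c : ℝ≥0∞)⁻¹ * μ (closedBall x.1 (r x)) := by
          refine ENNReal.tsum_le_tsum fun x => ?_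
          rw [← ENNReal.mul_le_iff_le_inv (by simpa) ENNReal.coe_ne_top]
          refine le_trans ?_ (hr x x.2).1.le
          gcongr
          exact hdiam x
      _ = (c : ℝ≥0∞)⁻¹ * μ (⋃ x ∈ T, closedBall x (r x)) := by
          rw [ENNReal.tsum_mul_left, measure_biUnion hT hdisj
            fun x _ => isClosed_closedBall.measurableSet]
      _ ≤ (c : ℝ≥0∞)⁻¹ * μ U := by
          gcongr
          refine iUnion₂_subset fun x hx => Subset.trans (closedBall_subset_closedBall ?_)
            (hRU x (hTs hx))
          exact (hr x hx).2.2.le.trans (min_le_left _ _)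

theorem exists_null_hausdorffMeasure_sdiff_le (μ : Measure X) [IsFiniteMeasure μ] {d : ℝ}
    (hd : 0 ≤ d) {c : ℝ≥0} (hc : c ≠ 0) {s U : Set X} (hU : IsOpen U) (hsU : s ⊆ U)
    (hs : ∀ x ∈ s, ∃ᶠ r in 𝓝[>] (0 : ℝ), c * ENNReal.ofReal (2 * r) ^ d < μ (closedBall x r)) :
    ∃ N, μ N = 0 ∧ μH[d] (s \ N) ≤ (c : ℝ≥0∞)⁻¹ * μ U := by
  choose T B hT hB hcover hsum using fun n : ℕ =>
    exists_countable_ae_cover_tsum_ediam_rpow_le μ hd hc hU hsU hs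
      (δ := 1 / ((n : ℝ) + 1)) (by positivity)
  have hlim : Tendsto (fun n : ℕ => ENNReal.ofReal (2 * (1 / ((n : ℝ) + 1)))) atTop (𝓝 0) := by
    simpa using ENNReal.tendsto_ofReal
      ((tendsto_one_div_add_atTop_nhds_zero_nat (𝕜 := ℝ)).const_mul 2)
  have (n : ℕ) : Countable (T n) := (hT n).to_subtype
  refine ⟨⋃ n, s \ ⋃ x, B n x, measure_iUnion_null hcover,
    (Measure.hausdorffMeasure_le_liminf_tsum d _ _ hlim B (.of_forall hB)
      (.of_forall fun n x hx => ?_)).trans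
    (liminf_le_of_frequently_le' (Frequently.of_forall hsum))⟩
  by_contra hxB
  exact hx.2 (mem_iUnion.2 ⟨n, hx.1, hxB⟩)

theorem ae_eventually_hausdorffMeasure_restrict_closedBall_le {d : ℝ} (hd : 0 ≤ d) {E : Set X}
    (hE : μH[d] E ≠ ⊤) {c : ℝ≥0} (hc : 1 < c) :
    ∀ᵐ x ∂(μH[d].restrict E), ∀ᶠ r in 𝓝[>] (0 : ℝ),
      μH[d].restrict E (closedBall x r) ≤ c * ENNReal.ofReal (2 * r) ^ d := by
  have := isFiniteMeasure_restrict.2 hE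
  set μ := μH[d].restrict E
  set s := {x | ¬ ∀ᶠ r in 𝓝[>] (0 : ℝ), μ (closedBall x r) ≤ c * ENNReal.ofReal (2 * r) ^ d}
  have hs : ∀ x ∈ s, ∃ᶠ r in 𝓝[>] (0 : ℝ), c * ENNReal.ofReal (2 * r) ^ d < μ (closedBall x r) :=
    fun x hx => (not_eventually.1 hx).mono fun r => not_le.1
  have hc0 : c ≠ 0 := (zero_lt_one.trans hc).ne'
  have hopen {U : Set X} (hU : IsOpen U) (hsU : s ⊆ U) : c * μ s ≤ μ U := by
    obtain ⟨N, hN, hle⟩ := exists_null_hausdorffMeasure_sdiff_le μ hd hc0 hU hsU hs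
    rw [ENNReal.mul_le_iff_le_inv (by simpa) ENNReal.coe_ne_top]
    calc μ s = μ (s \ N) := (measure_sdiff_null hN).symm
      _ ≤ μH[d] (s \ N) := Measure.restrict_apply_le _ _
      _ ≤ _ := hle
  have hle : c * μ s ≤ μ s := by
    rw [s.measure_eq_iInf_isOpen μ]
    refine le_iInf₂ fun U hsU => le_iInf fun hU => ?_
    rw [← s.measure_eq_iInf_isOpen μ]
    exact hopen hU hsU
  by_contra hpos
  have := ENNReal.mul_lt_mul_left hpos (measure_ne_top μ s) (ENNReal.one_lt_coe_iff.2 hc)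
  rw [one_mul] at this
  exact this.not_ge hle

theorem measure_eq_zero_of_frequently_le {μ : Measure X} [IsLocallyFiniteMeasure μ] {B : Set X}
    {θ : ℝ≥0∞} (hθ : θ < 1)
    (h : ∀ᵐ x ∂μ, x ∈ B →
      ∃ᶠ r in 𝓝[>] (0 : ℝ), μ (B ∩ closedBall x r) ≤ θ * μ (closedBall x r)) :
    μ B = 0 := by
  have hB : ∀ᵐ x ∂(μ.restrict B), x ∉ B := by
    filter_upwards [Besicovitch.ae_tendsto_measure_inter_div μ B, ae_restrict_of_ae h]
      with x hlim hx hxB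
    obtain ⟨r, hle, hlt⟩ := ((hx hxB).and_eventually (hlim.eventually_const_lt hθ)).exists
    exact hlt.not_ge (ENNReal.div_le_of_le_mul hle)
  rw [← Measure.restrict_apply_self]
  simpa only [ae_iff, not_not, ofPred_mem_eq] using hB

end Density

section ArcInterior

open Metric

/-- The points of `E` lying in the interior of an arc contained in `E`. At these points the lower
density of `E` is at least `1`. -/
def arcInterior {X : Type*} [TopologicalSpace X] (E : Set X) : Set X :=
  {x | ∃ f : ℝ → X, ContinuousOn f (Icc 0 1) ∧ InjOn f (Icc 0 1) ∧ MapsTo f (Icc 0 1) E ∧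
    ∃ t ∈ Ioo (0 : ℝ) 1, f t = x}

variable {X : Type*} [MetricSpace X] [MeasurableSpace X] [BorelSpace X] {E : Set X}

theorem eventually_ofReal_le_hausdorffMeasure_inter_ball {x : X} (h : x ∈ arcInterior E) :
    ∀ᶠ r in 𝓝[>] (0 : ℝ), ENNReal.ofReal (2 * r) ≤ μH[1] (E ∩ ball x r) := by
  obtain ⟨f, hf, hinj, hmaps, t, ht, rfl⟩ := h
  have := Measure.nullSingletonClass_hausdorff X one_pos
  have ht' : t ∈ Icc (0 : ℝ) 1 := Ioo_subset_Icc_self ht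
  have hleft : Icc 0 t ⊆ Icc (0 : ℝ) 1 := Icc_subset_Icc_right ht.2.le
  have hright : Icc t 1 ⊆ Icc (0 : ℝ) 1 := Icc_subset_Icc_left ht.1.le
  have hmeas : MeasurableSet (f '' Icc t 1) :=
    (isCompact_Icc.image_of_continuousOn (hf.mono hright)).isClosed.measurableSet
  have hinter : f '' Icc 0 t ∩ f '' Icc t 1 ⊆ {f t} := by
    rw [← hinj.image_inter hleft hright, Icc_inter_Icc_eq_singleton ht.1.le ht.2.le,
      image_singleton]
  have hpos : 0 < min (dist (f t) (f 0)) (dist (f t) (f 1)) :=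
    lt_min (dist_pos.2 fun h => ht.1.ne' (hinj ht' (by simp) h))
      (dist_pos.2 fun h => ht.2.ne (hinj ht' (by simp) h))
  filter_upwards [Ioo_mem_nhdsGT hpos] with r hr
  calc ENNReal.ofReal (2 * r) = ENNReal.ofReal r + ENNReal.ofReal r := by
        rw [← ENNReal.ofReal_add hr.1.le hr.1.le, two_mul]
    _ ≤ μH[1] (f '' Icc 0 t ∩ ball (f t) r) + μH[1] (f '' Icc t 1 ∩ ball (f t) r) := by
        gcongr
        · exact ofReal_le_hausdorffMeasure_inter_ball
            (isPreconnected_Icc.image f (hf.mono hleft)) (mem_image_of_mem f ⟨ht.1.le, le_rfl⟩)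
            (mem_image_of_mem f ⟨le_rfl, ht.1.le⟩) (hr.2.le.trans (min_le_left _ _))
        · exact ofReal_le_hausdorffMeasure_inter_ball
            (isPreconnected_Icc.image f (hf.mono hright)) (mem_image_of_mem f ⟨le_rfl, ht.2.le⟩)
            (mem_image_of_mem f ⟨ht.2.le, le_rfl⟩) (hr.2.le.trans (min_le_right _ _))
    _ = μH[1] (f '' Icc 0 t ∩ ball (f t) r ∪ f '' Icc t 1 ∩ ball (f t) r) :=
        (measure_union₀ (hmeas.inter isOpen_ball.measurableSet).nullMeasurableSet
          (measure_mono_null ((inter_subset_inter inter_subset_left inter_subset_left).trans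
            hinter) (measure_singleton _))).symm
    _ ≤ μH[1] (E ∩ ball (f t) r) := by
        rw [← union_inter_distrib_right]
        gcongr
        exact union_subset (hmaps.mono_left hleft).image_subset
          (hmaps.mono_left hright).image_subset

theorem exists_measurableSet_subset_arcInterior (hE : IsCompact E) (hc : IsPreconnected E)
    (hfin : μH[1] E ≠ ⊤) {x y : X} (hx : x ∈ E) (hy : y ∈ E) (hxy : x ≠ y) :
    ∃ A ⊆ arcInterior E, MeasurableSet A ∧ A ⊆ E ∧
      ∀ r ≤ dist x y, ENNReal.ofReal r ≤ μH[1] (A ∩ closedBall x r) := by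
  have := Measure.nullSingletonClass_hausdorff X one_pos
  obtain ⟨f, h0, h1, hfE, hf, hinj⟩ := exists_arc hE hc hfin hx hy hxy
  refine ⟨f '' Icc 0 1 \ {x, y}, ?_, ?_, ?_, fun r hr => ?_⟩
  · rintro z ⟨⟨t, ht, rfl⟩, hz⟩
    rw [mem_insert_iff, mem_singleton_iff, not_or] at hz
    exact ⟨f, hf, hinj, fun s _ => hfE s, t, ⟨lt_of_le_of_ne ht.1 fun h => hz.1 (h ▸ h0),
      lt_of_le_of_ne ht.2 fun h => hz.2 (h ▸ h1)⟩, rfl⟩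
  · exact (isCompact_Icc.image_of_continuousOn hf).isClosed.measurableSet.diff
      (Set.toFinite _).isClosed.measurableSet
  · exact sdiff_subset.trans (image_subset_iff.2 fun t _ => hfE t)
  · calc ENNReal.ofReal r ≤ μH[1] (f '' Icc 0 1 ∩ ball x r) :=
          ofReal_le_hausdorffMeasure_inter_ball (isPreconnected_Icc.image f hf) ⟨0, by simp, h0⟩
            ⟨1, by simp, h1⟩ hr
      _ = μH[1] ((f '' Icc 0 1 ∩ ball x r) \ {x, y}) :=
          (measure_sdiff_null ((Set.toFinite _).measure_zero _)).symm
      _ ≤ μH[1] ((f '' Icc 0 1 \ {x, y}) ∩ closedBall x r) :=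
          measure_mono fun z hz => ⟨⟨hz.1.1, hz.2⟩, ball_subset_closedBall hz.1.2⟩

variable [SecondCountableTopology X] [HasBesicovitchCovering X]

/-- At a point `x` where the upper density is at most `3 / 2`, balls `B_r(x)` have measure at most
`3 r`, of which the interior of an arc issuing from `x` occupies at least `r`. Hence the complement
of the arc interiors has density at most `2 / 3` there. -/
theorem ae_mem_arcInterior (hE : IsCompact E) (hc : IsPreconnected E) (hfin : μH[1] E ≠ ⊤) :
    ∀ᵐ x ∂(μH[1].restrict E), x ∈ arcInterior E := by
  have := Measure.nullSingletonClass_hausdorff X one_pos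
  rcases E.subsingleton_or_nontrivial with hsub | hnt
  · rw [Measure.restrict_eq_zero.2 (hsub.measure_zero _)]
    exact ae_zero.le trivial
  have := isFiniteMeasure_restrict.2 hfin
  refine measure_eq_zero_of_frequently_le (θ := (2 / 3 : ℝ≥0))
    (ENNReal.coe_lt_one_iff.2 <| (div_lt_one (by norm_num)).2 (by norm_num)) ?_
  filter_upwards [ae_restrict_mem hE.isClosed.measurableSet,
    ae_eventually_hausdorffMeasure_restrict_closedBall_le zero_le_one hfin (c := 3 / 2)
      (by norm_num)] with x hx hupper _
  obtain ⟨y, hy, hyx⟩ := hnt.exists_ne x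
  obtain ⟨A, hA, hAmeas, hAE, hAr⟩ :=
    exists_measurableSet_subset_arcInterior hE hc hfin hx hy hyx.symm
  refine Eventually.frequently ?_
  filter_upwards [hupper, Ioo_mem_nhdsGT (dist_pos.2 hyx.symm)] with r hupper hr
  set μ := μH[1].restrict E with hμ
  have hadd : μ ((arcInterior E)ᶜ ∩ closedBall x r) + ENNReal.ofReal r ≤ μ (closedBall x r) := by
    rw [← measure_inter_add_sdiff (closedBall x r) hAmeas, add_comm]
    refine add_le_add ?_ (measure_mono fun z hz => ⟨hz.2, fun hzA => hz.1 (hA hzA)⟩)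
    rw [hμ, Measure.restrict_eq_self _ (inter_subset_right.trans hAE), inter_comm]
    exact hAr r hr.2.le
  rw [ENNReal.rpow_one] at hupper
  lift μ (closedBall x r) to ℝ≥0 using measure_ne_top _ _ with a
  change μ ((arcInterior E)ᶜ ∩ closedBall x r) ≤ _
  lift μ ((arcInterior E)ᶜ ∩ closedBall x r) to ℝ≥0 using measure_ne_top _ _ with b
  lift r to ℝ≥0 using hr.1.le
  have htwo : ENNReal.ofReal (2 * (r : ℝ)) = ((2 * r : ℝ≥0) : ℝ≥0∞) := by
    rw [← ENNReal.ofReal_coe_nnreal]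
    rfl
  rw [htwo] at hupper
  rw [ENNReal.ofReal_coe_nnreal] at hadd
  norm_cast at hadd hupper ⊢
  rw [← NNReal.coe_le_coe] at hadd hupper ⊢
  push_cast at hadd hupper ⊢
  linarith

end ArcInterior

section Rectifiability

open Metric

variable {X : Type*} [MetricSpace X] [SecondCountableTopology X] [MeasurableSpace X] [BorelSpace X]
  [HasBesicovitchCovering X] {ι : Type*} [Finite ι] {G : ι → Set X}

theorem ae_tendsto_hausdorffMeasure_restrict_closedBall_div (hG : ∀ i, IsCompact (G i))
    (hc : ∀ i, IsPreconnected (G i)) (hfin : μH[1] (⋃ i, G i) ≠ ⊤) :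
    ∀ᵐ x ∂(μH[1].restrict (⋃ i, G i)), Tendsto (fun r : ℝ =>
      μH[1].restrict (⋃ i, G i) (closedBall x r) / ENNReal.ofReal (2 * r)) (𝓝[>] 0) (𝓝 1) := by
  have hupper := ae_all_iff.2 fun n : ℕ =>
    ae_eventually_hausdorffMeasure_restrict_closedBall_le zero_le_one hfin
      (c := 1 + 1 / ((n : ℝ≥0) + 1)) (lt_add_of_pos_right _ (by positivity))
  have hlower : ∀ᵐ x ∂(μH[1].restrict (⋃ i, G i)), ∃ i, x ∈ arcInterior (G i) := by
    refine (ae_restrict_iUnion_iff _ _).2 fun i => ?_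
    exact (ae_mem_arcInterior (hG i) (hc i)
      (measure_ne_top_of_subset (subset_iUnion G i) hfin)).mono
      fun x hx => ⟨i, hx⟩
  filter_upwards [hupper, hlower] with x hupper ⟨i, hi⟩
  refine tendsto_order.2 ⟨fun a ha => ?_, fun a ha => ?_⟩
  · filter_upwards [eventually_ofReal_le_hausdorffMeasure_inter_ball hi, self_mem_nhdsWithin]
      with r hr hr0
    refine ha.trans_le ((ENNReal.le_div_iff_mul_le (.inl ?_) (.inl ENNReal.ofReal_ne_top)).2 ?_)
    · exact (ENNReal.ofReal_pos.2 (mul_pos two_pos hr0)).ne'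
    · rw [one_mul, Measure.restrict_apply isClosed_closedBall.measurableSet, inter_comm]
      exact hr.trans (measure_mono (inter_subset_inter (subset_iUnion G i) ball_subset_closedBall))
  · have hlim : Tendsto (fun n : ℕ => ((1 + 1 / ((n : ℝ≥0) + 1) : ℝ≥0) : ℝ≥0∞)) atTop (𝓝 1) := by
      have := (tendsto_one_div_add_atTop_nhds_zero_nat (𝕜 := ℝ≥0)).const_add 1
      rw [add_zero] at this
      exact ENNReal.tendsto_coe.2 this
    obtain ⟨n, hn⟩ := (hlim.eventually_lt_const ha).exists
    filter_upwards [hupper n] with r hr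
    rw [ENNReal.rpow_one] at hr
    exact (ENNReal.div_le_of_le_mul hr).trans_lt hn

theorem ae_tendsto_hausdorffMeasure_inter_ball_div (hG : ∀ i, IsCompact (G i))
    (hc : ∀ i, IsPreconnected (G i)) (hfin : μH[1] (⋃ i, G i) ≠ ⊤) {K : Set X}
    (hK : K ⊆ ⋃ i, G i) :
    ∀ᵐ x ∂(μH[1].restrict K), Tendsto (fun r : ℝ =>
      μH[1] (K ∩ ball x r) / ENNReal.ofReal (2 * r)) (𝓝[>] 0) (𝓝 1) := by
  have hE := ae_tendsto_hausdorffMeasure_restrict_closedBall_div hG hc hfin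
  have := isFiniteMeasure_restrict.2 hfin
  set μ := μH[1].restrict (⋃ i, G i)
  have hμK : μ.restrict K = μH[1].restrict K := Measure.restrict_restrict_of_subset hK
  have hμball (x : X) (r : ℝ) : μ (K ∩ closedBall x r) = μH[1].restrict K (closedBall x r) := by
    rw [← hμK, Measure.restrict_apply isClosed_closedBall.measurableSet, inter_comm]
  rw [← hμK]
  filter_upwards [Besicovitch.ae_tendsto_measure_inter_div μ K, ae_restrict_of_ae hE]
    with x hKlim hElim
  have hprod := ENNReal.Tendsto.mul hKlim (.inl one_ne_zero) hElim (.inl one_ne_zero)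
  rw [one_mul] at hprod
  have hclosed : Tendsto (fun r : ℝ =>
      μH[1].restrict K (closedBall x r) / ENNReal.ofReal (2 * r)) (𝓝[>] 0) (𝓝 1) := by
    refine hprod.congr' ?_
    filter_upwards [hElim.eventually_const_lt zero_lt_one] with r hr
    rw [ENNReal.div_pos_iff] at hr
    rw [hμball, ← mul_div_assoc, ENNReal.div_mul_cancel hr.1 (measure_ne_top _ _)]
  refine (tendsto_measure_ball_div hclosed).congr fun r => ?_
  rw [Measure.restrict_apply isOpen_ball.measurableSet, inter_comm]

end Rectifiability

theorem isH1Rectifiable_of_subset_iUnion {ι : Type*} [Finite ι] {G : ι → Set Plane}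
    (hG : ∀ i, IsCompact (G i)) (hc : ∀ i, IsPreconnected (G i)) (hfin : H1 (⋃ i, G i) ≠ ⊤)
    {K : Set Plane} (hK : K ⊆ ⋃ i, G i) : IsH1Rectifiable K :=
  ⟨(measure_mono hK).trans_lt hfin.lt_top,
    ae_tendsto_hausdorffMeasure_inter_ball_div hG hc hfin hK⟩

/-! ### Limits of finite unions of continua -/

theorem exists_preconnected_cover {X : Type*} [TopologicalSpace X] {E : Set X} (hE : E.Nonempty)
    {n : ℕ} (hn : ENat.card (ConnectedComponents E) ≤ (n : ℕ∞)) :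
    ∃ c : Fin n → Set X, (∀ j, IsPreconnected (c j)) ∧ (∀ j, (c j).Nonempty) ∧ E = ⋃ j, c j := by
  have : Nonempty E := hE.to_subtype
  have : Finite (ConnectedComponents E) :=
    ENat.card_lt_top.1 (lt_of_le_of_lt hn (ENat.natCast_lt_top n))
  have := Fintype.ofFinite (ConnectedComponents E)
  have hcard : Fintype.card (ConnectedComponents E) ≤ Fintype.card (Fin n) := by
    rw [ENat.card_eq_coe_fintype_card] at hn
    rw [Fintype.card_fin]
    exact_mod_cast hn
  obtain ⟨e⟩ := Function.Embedding.nonempty_of_card_le hcard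
  have hsurj := Function.invFun_surjective e.injective
  choose r hr using fun q : ConnectedComponents E => ConnectedComponents.surjective_coe q
  refine ⟨fun j => Subtype.val '' connectedComponent (r (Function.invFun e j)),
    fun j => isPreconnected_connectedComponent.image _ continuous_subtype_val.continuousOn,
    fun j => ⟨_, mem_image_of_mem _ mem_connectedComponent⟩, ?_⟩
  refine Subset.antisymm (fun x hx => ?_) (iUnion_subset fun j => ?_)
  · obtain ⟨j, hj⟩ := hsurj ((⟨x, hx⟩ : E) : ConnectedComponents E)
    refine mem_iUnion.2 ⟨j, ⟨x, hx⟩, ?_, rfl⟩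
    have h := hr (Function.invFun e j)
    rw [hj] at h ⊢
    exact ConnectedComponents.coe_eq_coe'.1 h.symm
  · rintro _ ⟨x, _, rfl⟩
    exact x.2

theorem card_connectedComponents_le {X : Type*} [TopologicalSpace X] {E : Set X} {n : ℕ}
    {c : Fin n → Set X} (hc : ∀ j, IsPreconnected (c j)) (hne : ∀ j, (c j).Nonempty)
    (hE : E = ⋃ j, c j) : ENat.card (ConnectedComponents E) ≤ (n : ℕ∞) := by
  choose p hp using hne
  have hcE : ∀ j, c j ⊆ E := fun j => hE ▸ subset_iUnion c j
  let f : Fin n → ConnectedComponents E := fun j => ((⟨p j, hcE j (hp j)⟩ : E) : _)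
  have hf : Function.Surjective f := by
    intro q
    obtain ⟨x, rfl⟩ := ConnectedComponents.surjective_coe q
    obtain ⟨j, hj⟩ := mem_iUnion.1 (hE.subset x.2)
    refine ⟨j, ?_⟩
    have hpre : IsPreconnected (Subtype.val ⁻¹' c j : Set E) := by
      rw [← Topology.IsInducing.subtypeVal.isPreconnected_image, Subtype.image_preimage_coe,
        inter_eq_right.2 (hcE j)]
      exact hc j
    exact ConnectedComponents.coe_eq_coe'.2 (hpre.subset_connectedComponent hj (hp j))
  have := ENat.card_le_card_of_injective (Function.injective_surjInv hf)
  rwa [ENat.card_eq_coe_fintype_card (α := Fin n), Fintype.card_fin] at this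

theorem KuratowskiTendsto.exists_eq_iUnion_isPreconnected {X : Type*} [MetricSpace X]
    [SecondCountableTopology X] [MeasurableSpace X] [BorelSpace X] {E : ℕ → Set X} {F Q : Set X}
    (h : KuratowskiTendsto E atTop F) (hQ : IsCompact Q) (hE : ∀ k, E k ⊆ Q)
    (hne : ∀ k, (E k).Nonempty) {n : ℕ}
    (hn : ∀ k, ENat.card (ConnectedComponents (E k)) ≤ (n : ℕ∞)) {M : ℝ≥0∞} (hM : M ≠ ⊤)
    (hEM : ∀ k, μH[1] (E k) ≤ M) :
    ∃ G : Fin n → Set X, (∀ j, IsCompact (G j)) ∧ (∀ j, IsPreconnected (G j)) ∧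
      (∀ j, (G j).Nonempty) ∧ F = ⋃ j, G j ∧ μH[1] F ≠ ⊤ := by
  choose c hc hcne hcE using fun k => exists_preconnected_cover (hne k) (hn k)
  have hsub (k j) : c k j ⊆ E k := by
    rw [hcE k]
    exact subset_iUnion (c k) j
  obtain ⟨θ, G, hθ, hG⟩ := exists_subseq_kuratowskiTendsto c
  have hFG : F = ⋃ j, G j := by
    have hlim := KuratowskiTendsto.iUnion hG
    simp only [← hcE] at hlim
    exact (h.comp hθ.tendsto_atTop).unique hlim
  have hGQ (k j) : c (θ k) j ⊆ Q := (hsub _ j).trans (hE _)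
  refine ⟨G, fun j => ?_, fun j => ?_, fun j => ?_, hFG, ?_⟩
  · exact hQ.of_isClosed_subset (hG j).isClosed ((hG j).subset hQ.isClosed (.of_forall (hGQ · j)))
  · exact (hG j).isPreconnected hQ (.of_forall (hGQ · j)) (.of_forall fun k => hc _ j)
  · exact (hG j).nonempty hQ (.of_forall (hGQ · j)) (.of_forall fun k => hcne _ j)
  · have hle (j) : μH[1] (G j) ≤ 4 * M := (hG j).hausdorffMeasure_le
      (.of_forall fun k => hc _ j) (.of_forall fun k => (measure_mono (hsub _ j)).trans (hEM _))
    rw [hFG]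
    refine ((measure_iUnion_fintype_le _ G).trans_lt (ENNReal.sum_lt_top.2 fun j _ => ?_)).ne
    exact (hle j).trans_lt (by finiteness)

/-! ### Plane sets -/

theorem lipschitzWith_coord (i : Fin 2) : LipschitzWith 1 fun p : Plane => p i :=
  .of_dist_le_mul fun p q => by
    simpa [dist_eq_norm, Real.norm_eq_abs] using PiLp.norm_apply_le (p - q) i

theorem continuous_coord (i : Fin 2) : Continuous fun p : Plane => p i :=
  (lipschitzWith_coord i).continuous

theorem lipschitzWith_horizontal (c : ℝ) : LipschitzWith 1 fun s : ℝ => (!₂[s, c] : Plane) :=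
  .of_dist_le_mul fun s t => by
    simp [EuclideanSpace.dist_eq, Real.dist_eq, Real.sqrt_sq_eq_abs]

theorem lipschitzWith_vertical (c : ℝ) : LipschitzWith 1 fun s : ℝ => (!₂[c, s] : Plane) :=
  .of_dist_le_mul fun s t => by
    simp [EuclideanSpace.dist_eq, Real.dist_eq, Real.sqrt_sq_eq_abs]

theorem eq_vec (p : Plane) : p = !₂[p 0, p 1] := by
  ext i
  fin_cases i <;> rfl

theorem hausdorffMeasure_image_Icc_ne_top {X : Type*} [EMetricSpace X] [MeasurableSpace X]
    [BorelSpace X] {K : ℝ≥0} {f : ℝ → X} (hf : LipschitzWith K f) (a b : ℝ) :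
    μH[1] (f '' Icc a b) ≠ ⊤ := by
  have himage := hf.hausdorffMeasure_image_le zero_le_one (Icc a b)
  rw [hausdorffMeasure_real, Real.volume_Icc] at himage
  exact ne_top_of_le_ne_top (by finiteness) himage

theorem interior_eq_empty_of_hausdorffMeasure_ne_top {K : Set Plane} (hK : H1 K ≠ ⊤) :
    interior K = ∅ := by
  by_contra hne
  have hdim : dimH K ≤ (1 : ℝ≥0) := dimH_le_of_hausdorffMeasure_ne_top (by simpa using hK)
  rw [Real.dimH_of_nonempty_interior (nonempty_iff_ne_empty.2 hne),
    finrank_euclideanSpace_fin] at hdim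
  norm_num at hdim

theorem volume_eq_zero_of_hausdorffMeasure_ne_top {K : Set Plane} (hK : H1 K ≠ ⊤) :
    volume K = 0 := by
  have hnull : (Measure.hausdorffMeasure 2 : Measure Plane) K = 0 :=
    (Measure.hausdorffMeasure_zero_or_top (by norm_num : (1 : ℝ) < 2) K).resolve_right hK
  have : Measure.IsAddHaarMeasure (Measure.hausdorffMeasure 2 : Measure Plane) := by
    simpa using isAddHaarMeasure_hausdorffMeasure (E := Plane)
  exact Measure.absolutelyContinuous_isAddHaarMeasure volume (Measure.hausdorffMeasure 2) hnull

theorem closure_sdiff_of_subset {X : Type*} [TopologicalSpace X] {A K : Set X} (hA : IsClosed A)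
    (hK : interior K = ∅) (hKA : K ⊆ closure (interior A)) : closure (A \ K) = A := by
  have hint : closure (interior A) ⊆ closure (A \ K) := by
    refine closure_minimal ?_ isClosed_closure
    exact ((interior_eq_empty_iff_dense_compl.1 hK).open_subset_closure_inter
      isOpen_interior).trans (closure_mono (inter_subset_inter_left _ interior_subset))
  refine (closure_minimal sdiff_subset hA).antisymm fun x hx => ?_
  by_cases hxK : x ∈ K
  exacts [hint (hKA hxK), subset_closure ⟨hx, hxK⟩]

theorem mem_closure_of_forall_lineMap_mem {E : Type*} [NormedAddCommGroup E] [NormedSpace ℝ E]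
    {s : Set E} {p q : E} (h : ∀ t ∈ Ioo (0 : ℝ) 1, AffineMap.lineMap p q t ∈ s) :
    p ∈ closure s := by
  have hlim : Tendsto (AffineMap.lineMap p q) (𝓝[>] (0 : ℝ)) (𝓝 p) := by
    simpa using (AffineMap.lineMap_continuous (p := p) (q := q) |>.tendsto (0 : ℝ)).mono_left
      nhdsWithin_le_nhds
  exact mem_closure_of_tendsto hlim (mem_of_superset (Ioo_mem_nhdsGT zero_lt_one) h)

/-! ### Functions of bounded variation -/

theorem eVariationOn_le_of_edist_le {α E F : Type*} [LinearOrder α] [PseudoEMetricSpace E]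
    [PseudoEMetricSpace F] {f : α → E} {g : α → F} {s : Set α}
    (h : ∀ x ∈ s, ∀ y ∈ s, x ≤ y → edist (f y) (f x) ≤ edist (g y) (g x)) :
    eVariationOn f s ≤ eVariationOn g s :=
  iSup_mono fun q => Finset.sum_le_sum fun i _ =>
    h _ (q.2.2.2 i) _ (q.2.2.2 (i + 1)) (q.2.2.1 i.le_succ)

theorem boundedVariationOn_of_sub_le {α : Type*} [LinearOrder α] {f v : α → ℝ} {a b : α}
    (hv : MonotoneOn v (Icc a b))
    (hf : ∀ x ∈ Icc a b, ∀ y ∈ Icc a b, x ≤ y → f y - f x ≤ v y - v x) :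
    BoundedVariationOn f (Icc a b) := by
  rcases lt_or_ge b a with hba | hab
  · simp [Icc_eq_empty_of_lt hba, BoundedVariationOn]
  have hg : MonotoneOn (fun x => 2 * v x - f x) (Icc a b) := fun x hx y hy hxy => by
    linarith [hf x hx y hy hxy, hv hx hy hxy]
  refine ne_top_of_le_ne_top (b := eVariationOn (fun x => 2 * v x - f x) (Icc a b)) ?_ ?_
  · have hvar := hg.locallyBoundedVariationOn a b (left_mem_Icc.2 hab) (right_mem_Icc.2 hab)
    rwa [inter_self] at hvar
  · refine eVariationOn_le_of_edist_le fun x hx y hy hxy => ?_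
    rw [edist_dist, edist_dist, Real.dist_eq, Real.dist_eq]
    refine ENNReal.ofReal_le_ofReal ((abs_le.2 ⟨?_, ?_⟩).trans (le_abs_self _)) <;>
      linarith [hf x hx y hy hxy, hv hx hy hxy]

theorem boundedVariationOn_of_sub_le_measure {μ : Measure ℝ} [IsFiniteMeasure μ] {f : ℝ → ℝ}
    {a b : ℝ}
    (hf : ∀ x ∈ Icc a b, ∀ y ∈ Icc a b, x ≤ y → ENNReal.ofReal (f y - f x) ≤ μ (Ioc x y)) :
    BoundedVariationOn f (Icc a b) := by
  refine boundedVariationOn_of_sub_le (v := fun x => μ.real (Iic x))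
    (fun x _ y _ hxy => measureReal_mono (Iic_subset_Iic.2 hxy)) fun x hx y hy hxy => ?_
  have hsplit : μ.real (Iic y) = μ.real (Iic x) + μ.real (Ioc x y) := by
    rw [← Iic_union_Ioc_eq_Iic hxy]
    exact measureReal_union (Iic_disjoint_Ioc le_rfl) measurableSet_Ioc
  have hle : f y - f x ≤ μ.real (Ioc x y) :=
    (ENNReal.ofReal_le_iff_le_toReal (measure_ne_top μ _)).1 (hf x hx y hy hxy)
  linarith

/-! ### Subgraphs -/

/-- The part of the subgraph `S_h` in `closure Ω`; it is the closure of every composite of height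
`h`. A constant function gives a rectangle. -/
def truncatedSubgraph (l L : ℝ) (h : ℝ → ℝ) : Set Plane :=
  {p | p 0 ∈ Icc (-l) l ∧ p 1 ∈ Icc (-L) (h (p 0))}

theorem mem_truncatedSubgraph_vec {l L : ℝ} {h : ℝ → ℝ} {x y : ℝ} :
    !₂[x, y] ∈ truncatedSubgraph l L h ↔ x ∈ Icc (-l) l ∧ y ∈ Icc (-L) (h x) :=
  Iff.rfl

theorem isOpen_Omega (l L : ℝ) : IsOpen (Omega l L) :=
  (isOpen_lt continuous_const (continuous_coord 0)).inter
    ((isOpen_lt (continuous_coord 0) continuous_const).inter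
      (isOpen_lt continuous_const (continuous_coord 1)))

theorem closure_Omega {l L : ℝ} (hl : 0 < l) :
    closure (Omega l L) = {p | -l ≤ p 0 ∧ p 0 ≤ l ∧ -L ≤ p 1} := by
  refine Subset.antisymm (closure_minimal (fun p hp => ⟨hp.1.le, hp.2.1.le, hp.2.2.le⟩) ?_) ?_
  · exact (isClosed_le continuous_const (continuous_coord 0)).inter
      ((isClosed_le (continuous_coord 0) continuous_const).inter
        (isClosed_le continuous_const (continuous_coord 1)))
  · rintro p ⟨hleft, hright, hbot⟩
    refine mem_closure_of_forall_lineMap_mem (q := !₂[0, -L + 1]) fun t ht => ?_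
    obtain ⟨ht0, ht1⟩ := ht
    refine ⟨?_, ?_, ?_⟩ <;> simp [AffineMap.lineMap_apply_module] <;> nlinarith

theorem subgraph_inter_closure_Omega {l : ℝ} (hl : 0 < l) (L : ℝ) (h : ℝ → ℝ) :
    subgraph l h ∩ closure (Omega l L) = truncatedSubgraph l L h := by
  rw [closure_Omega hl]
  ext p
  simp only [subgraph, truncatedSubgraph, mem_inter_iff, mem_ofPred_eq, mem_Icc]
  tauto

theorem crackedSubgraph_eq {l : ℝ} (hl : 0 < l) (L : ℝ) (h : ℝ → ℝ) (K : Set Plane) :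
    crackedSubgraph l L h K = truncatedSubgraph l L h \ K := by
  rw [crackedSubgraph, sdiff_inter_right_comm, subgraph_inter_closure_Omega hl]

theorem isClosed_truncatedSubgraph_iff {l L : ℝ} {h : ℝ → ℝ}
    (hh : ∀ x ∈ Icc (-l) l, -L ≤ h x) :
    IsClosed (truncatedSubgraph l L h) ↔ UpperSemicontinuousOn h (Icc (-l) l) := by
  rw [upperSemicontinuousOn_iff_isClosed_hypograph isClosed_Icc]
  constructor <;> intro hclosed
  · have hvec : Continuous fun q : ℝ × ℝ => (!₂[q.1, q.2] : Plane) := by fun_prop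
    convert (((isClosed_Icc (a := -l) (b := l)).preimage continuous_fst).inter
      (isClosed_le continuous_snd (continuous_const (y := -L)))).union
      (hclosed.preimage hvec) using 1
    ext q
    simp only [mem_ofPred_eq, mem_union, mem_inter_iff, mem_preimage, mem_truncatedSubgraph_vec]
    have := hh q.1
    grind
  · convert (hclosed.preimage ((continuous_coord 0).prodMk (continuous_coord 1))).inter
      (isClosed_le (continuous_const (y := -L)) (continuous_coord 1)) using 1
    ext p
    simp only [truncatedSubgraph, mem_Icc, mem_ofPred_eq, mem_preimage, mem_inter_iff]
    tauto

theorem isCompact_rectangle (l L R : ℝ) : IsCompact (truncatedSubgraph l L fun _ => R) := by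
  have hpi : truncatedSubgraph l L (fun _ => R) = WithLp.ofLp ⁻¹' (Set.pi univ fun i : Fin 2 =>
      Icc ((![-l, -L] : Fin 2 → ℝ) i) ((![l, R] : Fin 2 → ℝ) i)) := by
    ext p
    simp [truncatedSubgraph, Pi.le_def, Fin.forall_fin_two]
    tauto
  rw [hpi]
  exact (EuclideanSpace.equiv (Fin 2) ℝ).toHomeomorph.isCompact_preimage.2
    (isCompact_univ_pi fun i => isCompact_Icc)

theorem zero_mem_rectangle {l L R : ℝ} (hl : 0 ≤ l) (hL : 0 ≤ L) (hR : 0 ≤ R) :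
    (0 : Plane) ∈ truncatedSubgraph l L fun _ => R :=
  ⟨⟨neg_nonpos.2 hl, hl⟩, neg_nonpos.2 hL, hR⟩

theorem truncatedSubgraph_subset_iff {l L : ℝ} {h h' : ℝ → ℝ}
    (hh : ∀ x ∈ Icc (-l) l, -L ≤ h x) :
    truncatedSubgraph l L h ⊆ truncatedSubgraph l L h' ↔ ∀ x ∈ Icc (-l) l, h x ≤ h' x := by
  refine ⟨fun hsub x hx => ?_, fun hle _ hp => ⟨hp.1, hp.2.1, hp.2.2.trans (hle _ hp.1)⟩⟩
  exact (hsub (mem_truncatedSubgraph_vec.2 ⟨hx, hh x hx, le_rfl⟩)).2.2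

theorem closure_interior_subgraph_inter_subset {l L : ℝ} (hl : 0 < l) (hL : 0 < L) {h : ℝ → ℝ}
    (hh : ∀ x ∈ Icc (-l) l, 0 ≤ h x) :
    closure (interior (subgraph l h)) ∩ closure (Omega l L) ⊆
      closure (interior (truncatedSubgraph l L h)) := by
  rintro p ⟨hp, hpΩ⟩
  rw [closure_Omega hl] at hpΩ
  obtain ⟨hleft, hright, hbot⟩ := hpΩ
  rcases hbot.lt_or_eq with hlt | heq
  · have hV : IsOpen {q : Plane | -L < q 1} := isOpen_lt continuous_const (continuous_coord 1)
    refine closure_mono (interior_maximal ?_ (hV.inter isOpen_interior))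
      (hV.inter_closure ⟨hlt, hp⟩)
    rintro q ⟨hqL, hq⟩
    obtain ⟨hq0, hq1, hqh⟩ := interior_subset hq
    exact ⟨⟨hq0, hq1⟩, le_of_lt hqL, hqh⟩
  · have hbox : Omega l L ∩ {q | q 1 < 0} ⊆ interior (truncatedSubgraph l L h) := by
      refine interior_maximal ?_ ((isOpen_Omega l L).inter
        (isOpen_lt (continuous_coord 1) continuous_const))
      rintro q ⟨⟨hq0, hq1, hqL⟩, hq⟩
      exact ⟨⟨hq0.le, hq1.le⟩, hqL.le, (le_of_lt hq).trans (hh _ ⟨hq0.le, hq1.le⟩)⟩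
    refine closure_mono hbox (mem_closure_of_forall_lineMap_mem (q := !₂[0, -L / 2]) fun t ht => ?_)
    obtain ⟨ht0, ht1⟩ := ht
    refine ⟨⟨?_, ?_, ?_⟩, ?_⟩ <;> simp [AffineMap.lineMap_apply_module] <;> nlinarith

section IsHeightCrack

variable {l L : ℝ} {Λ : ℝ≥0∞} {h : ℝ → ℝ} {K : Set Plane}

theorem IsHeight.isClosed_truncatedSubgraph (hL : 0 ≤ L) (hh : IsHeight l Λ h) :
    IsClosed (truncatedSubgraph l L h) :=
  (isClosed_truncatedSubgraph_iff fun x hx => (neg_nonpos.2 hL).trans (hh.1 x hx).1).2 hh.2.1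

theorem IsHeightCrack.closure_eq (hl : 0 < l) (hL : 0 < L) (H : IsHeightCrack l L Λ h K) :
    closure (crackedSubgraph l L h K) = truncatedSubgraph l L h := by
  obtain ⟨hh, ⟨hKΩ, -, hK⟩, hKh⟩ := H
  rw [crackedSubgraph_eq hl]
  exact closure_sdiff_of_subset (hh.isClosed_truncatedSubgraph hL.le)
    (interior_eq_empty_of_hausdorffMeasure_ne_top hK.1.ne)
    ((subset_inter hKh hKΩ).trans
      (closure_interior_subgraph_inter_subset hl hL fun x hx => (hh.1 x hx).1))

theorem IsHeightCrack.interior_eq (hl : 0 < l) (H : IsHeightCrack l L Λ h K) :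
    interior (crackedSubgraph l L h K) = interior (truncatedSubgraph l L h) \ K := by
  rw [crackedSubgraph_eq hl, sdiff_eq, interior_inter, H.2.1.2.1.isOpen_compl.interior_eq, sdiff_eq]

theorem IsHeightCrack.volume_eq (hl : 0 < l) (H : IsHeightCrack l L Λ h K) :
    volume (crackedSubgraph l L h K) = volume (truncatedSubgraph l L h) := by
  rw [crackedSubgraph_eq hl]
  exact measure_sdiff_null (volume_eq_zero_of_hausdorffMeasure_ne_top H.2.1.2.2.1.ne)

end IsHeightCrack

/-! ### Boundary length and oscillation of heights -/

theorem inter_frontier_nonempty_of_isPreconnected {X : Type*} [TopologicalSpace X] {s B : Set X}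
    (hs : IsPreconnected s) (hB : (s ∩ B).Nonempty) (hB' : (s ∩ Bᶜ).Nonempty) :
    (s ∩ frontier B).Nonempty := by
  by_contra hempty
  have hfront : ∀ x ∈ s, x ∉ frontier B := fun x hx hxB => hempty ⟨x, hx, hxB⟩
  obtain ⟨x, -, hx, hx'⟩ := hs (interior B) (interior Bᶜ) isOpen_interior isOpen_interior
    (fun x hx => by
      have := hfront x hx
      rw [← mem_compl_iff, compl_frontier_eq_union_interior] at this
      exact this)
    (hB.imp fun x hx => ⟨hx.1, self_sdiff_frontier B ▸ ⟨hx.2, hfront x hx.1⟩⟩)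
    (hB'.imp fun x hx =>
      ⟨hx.1, self_sdiff_frontier Bᶜ ▸ ⟨hx.2, frontier_compl B ▸ hfront x hx.1⟩⟩)
  exact interior_subset hx' (interior_subset hx)

theorem volume_le_hausdorffMeasure_frontier {A : Set Plane} (hA : IsClosed A) {a b : ℝ} {Y : Set ℝ}
    (ha : ∀ y ∈ Y, !₂[a, y] ∉ A) (hb : ∀ y ∈ Y, !₂[b, y] ∈ A) :
    volume Y ≤ H1 (frontier A ∩ {p | p 0 ∈ uIcc a b \ {a} ∧ p 1 ∈ Y}) := by
  have hsub : Y ⊆ (fun p : Plane => p 1) ''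
      (frontier A ∩ {p | p 0 ∈ uIcc a b \ {a} ∧ p 1 ∈ Y}) := by
    intro y hy
    have hcont : Continuous fun s : ℝ => (!₂[s, y] : Plane) :=
      (lipschitzWith_horizontal y).continuous
    obtain ⟨s, hs, hsA⟩ := inter_frontier_nonempty_of_isPreconnected isPreconnected_uIcc
      (B := (fun s : ℝ => (!₂[s, y] : Plane)) ⁻¹' A)
      ⟨b, right_mem_uIcc, hb y hy⟩ ⟨a, left_mem_uIcc, ha y hy⟩
    have hfront : !₂[s, y] ∈ frontier A := hcont.frontier_preimage_subset A hsA
    refine ⟨!₂[s, y], ⟨hfront, ⟨hs, ?_⟩, hy⟩, rfl⟩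
    rintro rfl
    exact ha y hy (hA.frontier_subset hfront)
  calc volume Y ≤ volume ((fun p : Plane => p 1) ''
      (frontier A ∩ {p | p 0 ∈ uIcc a b \ {a} ∧ p 1 ∈ Y})) := measure_mono hsub
    _ ≤ H1 (frontier A ∩ {p | p 0 ∈ uIcc a b \ {a} ∧ p 1 ∈ Y}) := by
      simpa [hausdorffMeasure_real] using
        (lipschitzWith_coord 1).hausdorffMeasure_image_le zero_le_one
          (frontier A ∩ {p | p 0 ∈ uIcc a b \ {a} ∧ p 1 ∈ Y})

theorem sub_le_hausdorffMeasure_frontier {l L : ℝ} {h : ℝ → ℝ}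
    (hA : IsClosed (truncatedSubgraph l L h)) {a b c : ℝ} (hb : b ∈ Icc (-l) l) (hc : h a ≤ c)
    (hcL : -L ≤ c) :
    ENNReal.ofReal (h b - c) ≤
      H1 (frontier (truncatedSubgraph l L h) ∩ {p | p 0 ∈ uIcc a b \ {a} ∧ c < p 1}) := by
  rw [← Real.volume_Ioc]
  refine (volume_le_hausdorffMeasure_frontier hA (a := a) (b := b) (fun y hy hmem => ?_)
    fun y hy => ?_).trans (measure_mono (inter_subset_inter_right _ fun p hp => ⟨hp.1, hp.2.1⟩))
  · exact (hc.trans_lt hy.1).not_ge (mem_truncatedSubgraph_vec.1 hmem).2.2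
  · exact mem_truncatedSubgraph_vec.2 ⟨hb, hcL.trans hy.1.le, hy.2⟩

theorem boundedVariationOn_height {l L : ℝ} {h : ℝ → ℝ} (hh : ∀ x ∈ Icc (-l) l, -L ≤ h x)
    (hA : IsClosed (truncatedSubgraph l L h))
    (hfin : H1 (frontier (truncatedSubgraph l L h)) ≠ ⊤) :
    BoundedVariationOn h (Icc (-l) l) := by
  have hcoord : Measurable fun p : Plane => p 0 := (continuous_coord 0).measurable
  have : IsFiniteMeasure (H1.restrict (frontier (truncatedSubgraph l L h))) :=
    isFiniteMeasure_restrict.2 hfin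
  refine boundedVariationOn_of_sub_le_measure
    (μ := (H1.restrict (frontier (truncatedSubgraph l L h))).map fun p => p 0)
    fun x hx y hy hxy => ?_
  rw [Measure.map_apply hcoord measurableSet_Ioc,
    Measure.restrict_apply (hcoord measurableSet_Ioc), inter_comm]
  refine (sub_le_hausdorffMeasure_frontier hA hy le_rfl (hh x hx)).trans
    (measure_mono (inter_subset_inter_right _ ?_))
  rintro p ⟨⟨hp, hpx⟩, -⟩
  rw [uIcc_of_le hxy] at hp
  exact ⟨lt_of_le_of_ne hp.1 (Ne.symm hpx), hp.2⟩

theorem volume_box (a b c d : ℝ) :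
    volume {p : Plane | p 0 ∈ Ioo a b ∧ p 1 ∈ Ioo c d} =
      ENNReal.ofReal (b - a) * ENNReal.ofReal (d - c) := by
  have hpi := (PiLp.volume_preserving_ofLp (Fin 2)).measure_preimage
    (s := Set.pi univ fun i : Fin 2 => Ioo ((![a, c] : Fin 2 → ℝ) i) ((![b, d] : Fin 2 → ℝ) i))
    (MeasurableSet.univ_pi fun i => measurableSet_Ioo).nullMeasurableSet
  rw [Real.volume_pi_Ioo, Fin.prod_univ_two] at hpi
  simp only [Matrix.cons_val_zero, Matrix.cons_val_one, Matrix.cons_val_fin_one] at hpi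
  rw [← hpi]
  congr 1
  ext p
  simp [Set.mem_pi, Fin.forall_fin_two]

-- Either the height drops to half its value at some point, which costs boundary length, or the
-- area is at least `l * h x`.
theorem height_le {l L : ℝ} (hl : 0 < l) (hL : 0 ≤ L) {h : ℝ → ℝ}
    (hh : ∀ x ∈ Icc (-l) l, 0 ≤ h x) (hA : IsClosed (truncatedSubgraph l L h)) {M V : ℝ}
    (hM0 : 0 ≤ M) (hV0 : 0 ≤ V)
    (hM : H1 (Omega l L ∩ frontier (truncatedSubgraph l L h)) ≤ ENNReal.ofReal M)
    (hV : volume (truncatedSubgraph l L h) ≤ ENNReal.ofReal V) {x : ℝ} (hx : x ∈ Ioo (-l) l) :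
    h x ≤ 2 * M + V / l := by
  have hx' := Ioo_subset_Icc_self hx
  have hVl : 0 ≤ V / l := by positivity
  have hhx : -L ≤ h x / 2 := by linarith [hh x hx']
  by_cases hlow : ∃ a ∈ Ioo (-l) l, h a ≤ h x / 2
  · obtain ⟨a, ha, hax⟩ := hlow
    have hjump : ENNReal.ofReal (h x - h x / 2) ≤ ENNReal.ofReal M := by
      refine (sub_le_hausdorffMeasure_frontier hA hx' hax hhx).trans (le_trans (measure_mono ?_) hM)
      rintro p ⟨hp, ⟨hp0, -⟩, hp1⟩
      obtain ⟨hleft, hright⟩ := ordConnected_Ioo.uIcc_subset ha hx hp0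
      exact ⟨⟨hleft, hright, hhx.trans_lt hp1⟩, hp⟩
    rw [ENNReal.ofReal_le_ofReal_iff hM0] at hjump
    linarith
  · push Not at hlow
    have harea : volume {p : Plane | p 0 ∈ Ioo (-l) l ∧ p 1 ∈ Ioo 0 (h x / 2)} ≤
        ENNReal.ofReal V := by
      refine le_trans (measure_mono ?_) hV
      rintro p ⟨hp0, hp1⟩
      exact ⟨Ioo_subset_Icc_self hp0, by linarith [hp1.1], hp1.2.le.trans (hlow _ hp0).le⟩
    rw [volume_box, ← ENNReal.ofReal_mul (by linarith),
      ENNReal.ofReal_le_ofReal_iff hV0] at harea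
    have : h x ≤ V / l := (le_div_iff₀ hl).2 (by linarith)
    linarith

theorem hausdorffMeasure_rectangle_sdiff_ne_top (l L R : ℝ) :
    H1 ((truncatedSubgraph l L fun _ => R) \ Omega l L) ≠ ⊤ := by
  have hsub : (truncatedSubgraph l L fun _ => R) \ Omega l L ⊆
      (fun t => !₂[t, -L]) '' Icc (-l) l ∪
        ((fun t => !₂[-l, t]) '' Icc (-L) R ∪ (fun t => !₂[l, t]) '' Icc (-L) R) := by
    rintro p ⟨⟨hp0, hp1⟩, hp⟩
    rw [eq_vec p] at hp ⊢
    by_cases hbot : p 1 = -L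
    · exact Or.inl ⟨p 0, hp0, by rw [hbot]⟩
    by_cases hleft : p 0 = -l
    · exact Or.inr (Or.inl ⟨p 1, hp1, by rw [hleft]⟩)
    by_cases hright : p 0 = l
    · exact Or.inr (Or.inr ⟨p 1, hp1, by rw [hright]⟩)
    exact absurd ⟨lt_of_le_of_ne hp0.1 (Ne.symm hleft), lt_of_le_of_ne hp0.2 hright,
      lt_of_le_of_ne hp1.1 (Ne.symm hbot)⟩ hp
  exact ne_top_of_le_ne_top (measure_union_ne_top
    (hausdorffMeasure_image_Icc_ne_top (lipschitzWith_horizontal _) _ _)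
    (measure_union_ne_top (hausdorffMeasure_image_Icc_ne_top (lipschitzWith_vertical _) _ _)
      (hausdorffMeasure_image_Icc_ne_top (lipschitzWith_vertical _) _ _))) (measure_mono hsub)

/-! ### Limits of layers -/

theorem exists_truncatedSubgraph_eq {l L R : ℝ} {A : Set Plane} (hA : IsClosed A)
    (hAR : A ⊆ truncatedSubgraph l L fun _ => R) (hbot : ∀ x ∈ Icc (-l) l, !₂[x, -L] ∈ A)
    (hdown : ∀ p ∈ A, ∀ y ∈ Icc (-L) (p 1), !₂[p 0, y] ∈ A) :
    ∃ h, truncatedSubgraph l L h = A := by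
  have hbdd : ∀ x, BddAbove {y | !₂[x, y] ∈ A} := fun x => ⟨R, fun y hy => (hAR hy).2.2⟩
  have htop : ∀ x ∈ Icc (-l) l, !₂[x, sSup {y | !₂[x, y] ∈ A}] ∈ A := fun x hx =>
    (hA.preimage (lipschitzWith_vertical x).continuous).csSup_mem ⟨-L, hbot x hx⟩ (hbdd x)
  refine ⟨fun x => sSup {y | !₂[x, y] ∈ A}, Subset.antisymm (fun p hp => ?_) fun p hp => ?_⟩
  · rw [eq_vec p]
    exact hdown _ (htop _ hp.1) _ hp.2
  · rw [eq_vec p] at hp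
    exact ⟨(hAR hp).1, (hAR hp).2.1, le_csSup (hbdd (p 0)) hp⟩

theorem rectangle_zero_subset_closure {l L : ℝ} (hl : 0 < l) (hL : 0 < L) {Λ : ℝ≥0∞}
    {S : Set Plane} (hS : S ∈ admissibleSubgraphs l L Λ) :
    (truncatedSubgraph l L fun _ => 0) ⊆ closure S := by
  obtain ⟨h, K, H, rfl⟩ := hS
  rw [H.closure_eq hl hL, truncatedSubgraph_subset_iff fun _ _ => neg_nonpos.2 hL.le]
  exact fun x hx => (H.1.1 x hx).1

theorem nonempty_of_mem_admissibleSubgraphs {l L : ℝ} (hl : 0 < l) (hL : 0 < L) {Λ : ℝ≥0∞}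
    {S : Set Plane} (hS : S ∈ admissibleSubgraphs l L Λ) : S.Nonempty :=
  closure_nonempty_iff.1
    ⟨0, rectangle_zero_subset_closure hl hL hS (zero_mem_rectangle hl.le hL.le le_rfl)⟩

theorem frontier_nonempty_of_mem_admissibleSubgraphs {l L : ℝ} (hl : 0 < l) (hL : 0 < L)
    {Λ : ℝ≥0∞} {S : Set Plane} (hS : S ∈ admissibleSubgraphs l L Λ) : (frontier S).Nonempty := by
  refine nonempty_frontier_iff.2 ⟨nonempty_of_mem_admissibleSubgraphs hl hL hS, ?_⟩
  obtain ⟨h, K, -, rfl⟩ := hS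
  refine (ne_univ_iff_exists_notMem _).2 ⟨!₂[l + 1, 0], fun hmem => ?_⟩
  rw [crackedSubgraph_eq hl] at hmem
  exact (lt_add_one l).not_ge (mem_truncatedSubgraph_vec.1 hmem.1).1.2

theorem exists_height_of_kuratowskiTendsto {l L R : ℝ} {Λ : ℝ≥0∞} (hl : 0 < l) (hL : 0 < L)
    {S : ℕ → Set Plane} (hS : ∀ k, S k ∈ admissibleSubgraphs l L Λ)
    (hR : ∀ k, closure (S k) ⊆ truncatedSubgraph l L fun _ => R) {A : Set Plane}
    (hA : KuratowskiTendsto (fun k => closure (S k)) atTop A) (hfin : H1 (frontier A) ≠ ⊤) :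
    ∃ h, IsHeight l Λ h ∧ truncatedSubgraph l L h = A := by
  have hrect : (truncatedSubgraph l L fun _ => 0) ⊆ A :=
    hA.superset (.of_forall fun k => rectangle_zero_subset_closure hl hL (hS k))
  choose hk K H hSK using hS
  have hcl : ∀ k, closure (S k) = truncatedSubgraph l L (hk k) := fun k => by
    rw [hSK k, (H k).closure_eq hl hL]
  have hdown : ∀ p ∈ A, ∀ y ∈ Icc (-L) (p 1), !₂[p 0, y] ∈ A := fun p hp y hy => by
    have hlower := hA.mapsTo (g := fun w : Plane => !₂[w 0, min (w 1) y]) (by fun_prop) hA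
      (.of_forall fun k w hw => by
        rw [hcl] at hw ⊢
        exact mem_truncatedSubgraph_vec.2
          ⟨hw.1, le_min hw.2.1 hy.1, (min_le_left _ _).trans hw.2.2⟩)
    simpa only [min_eq_right hy.2] using hlower hp
  have hΛ : A ⊆ {p | ENNReal.ofReal (p 1) ≤ Λ} :=
    hA.subset (isClosed_le (ENNReal.continuous_ofReal.comp (continuous_coord 1)) continuous_const)
      (.of_forall fun k p hp => by
        rw [hcl] at hp
        exact (ENNReal.ofReal_le_ofReal hp.2.2).trans ((H k).1.1 _ hp.1).2)
  obtain ⟨h, rfl⟩ := exists_truncatedSubgraph_eq hA.isClosed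
    (hA.subset (isCompact_rectangle l L R).isClosed (.of_forall hR))
    (fun x hx => hrect (mem_truncatedSubgraph_vec.2 ⟨hx, le_rfl, neg_nonpos.2 hL.le⟩)) hdown
  have hnonneg : ∀ x ∈ Icc (-l) l, 0 ≤ h x :=
    (truncatedSubgraph_subset_iff fun _ _ => neg_nonpos.2 hL.le).1 hrect
  have hbelow : ∀ x ∈ Icc (-l) l, -L ≤ h x := fun x hx =>
    (neg_nonpos.2 hL.le).trans (hnonneg x hx)
  exact ⟨h, ⟨fun x hx => ⟨hnonneg x hx,
    hΛ (mem_truncatedSubgraph_vec.2 ⟨hx, hbelow x hx, le_rfl⟩)⟩,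
    (isClosed_truncatedSubgraph_iff hbelow).1 hA.isClosed,
    boundedVariationOn_height hbelow hA.isClosed hfin⟩, rfl⟩

theorem frontier_subset_inter_of_union_eq_univ {X : Type*} [TopologicalSpace X] {A C : Set X}
    (hA : IsClosed A) (hC : IsClosed C) (hAC : A ∪ C = univ) : frontier A ⊆ A ∩ C := by
  have hcompl : Aᶜ ⊆ C := compl_subset_iff_union.2 hAC
  rw [frontier_eq_closure_inter_closure, hA.closure_eq]
  exact inter_subset_inter_right _ (closure_minimal hcompl hC)

theorem IsHeight.exists_isHeightCrack {l L : ℝ} {Λ : ℝ≥0∞} (hl : 0 < l) (hL : 0 < L) {h : ℝ → ℝ}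
    (hh : IsHeight l Λ h) {C : Set Plane} (hC : IsClosed C)
    (hAC : truncatedSubgraph l L h ∪ C = univ)
    (hrect : ∀ K ⊆ truncatedSubgraph l L h ∩ C, IsH1Rectifiable K) :
    ∃ K, IsHeightCrack l L Λ h K ∧
      closure (crackedSubgraph l L h K) = truncatedSubgraph l L h ∧
      interior (crackedSubgraph l L h K) = Cᶜ := by
  have hsub := subgraph_inter_closure_Omega hl L h
  have H : IsHeightCrack l L Λ h
      (truncatedSubgraph l L h ∩ C ∩ closure (interior (subgraph l h))) :=
    ⟨hh, ⟨(inter_subset_left.trans inter_subset_left).trans (hsub ▸ inter_subset_right),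
      ((hh.isClosed_truncatedSubgraph hL.le).inter hC).inter isClosed_closure,
      hrect _ inter_subset_left⟩, inter_subset_right⟩
  refine ⟨_, H, H.closure_eq hl hL, ?_⟩
  rw [H.interior_eq hl]
  have hCA : Cᶜ ⊆ interior (truncatedSubgraph l L h) :=
    interior_maximal (compl_subset_iff_union.2 (union_comm _ C ▸ hAC)) hC.isOpen_compl
  refine Subset.antisymm (fun x ⟨hx, hxK⟩ hxC => hxK ⟨⟨interior_subset hx, hxC⟩, ?_⟩)
    fun x hx => ⟨hCA hx, fun hxK => hx hxK.1.2⟩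
  exact subset_closure (interior_mono (hsub ▸ inter_subset_left) hx)

theorem exists_isHeightCrack_boundaryTendsto {l L R : ℝ} {Λ : ℝ≥0∞} (hl : 0 < l) (hL : 0 < L)
    {S : ℕ → Set Plane} (hS : ∀ k, S k ∈ admissibleSubgraphs l L Λ)
    (hR : ∀ k, closure (S k) ⊆ truncatedSubgraph l L fun _ => R) {n : ℕ}
    (hn : ∀ k, ENat.card (ConnectedComponents (frontier (S k))) ≤ (n : ℕ∞)) {N : ℝ≥0∞}
    (hN : N ≠ ⊤) (hSN : ∀ k, H1 (frontier (S k)) ≤ N) {A C : Set Plane}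
    (hA : KuratowskiTendsto (fun k => closure (S k)) atTop A)
    (hC : KuratowskiTendsto (fun k => (interior (S k))ᶜ) atTop C) :
    ∃ h K, IsHeightCrack l L Λ h K ∧ BoundaryTendsto S atTop (crackedSubgraph l L h K) ∧
      ENat.card (ConnectedComponents (frontier (crackedSubgraph l L h K))) ≤ (n : ℕ∞) := by
  have hcover : ∀ k, closure (S k) ∪ (interior (S k))ᶜ = univ := fun k =>
    closure_union_compl_interior _
  have hAC : A ∪ C = univ := hA.union_eq_univ hC (.of_forall hcover)
  have hboundary : KuratowskiTendsto (fun k => frontier (S k)) atTop (A ∩ C) :=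
    hA.inter_of_union_eq_univ hC (fun _ => isClosed_closure)
      (fun _ => isOpen_interior.isClosed_compl) hcover
  obtain ⟨G, hGcompact, hGconn, hGne, hG, hGfin⟩ := hboundary.exists_eq_iUnion_isPreconnected
    (isCompact_rectangle l L R) (fun k => frontier_subset_closure.trans (hR k))
    (fun k => frontier_nonempty_of_mem_admissibleSubgraphs hl hL (hS k)) hn hN hSN
  have hrect : ∀ K ⊆ A ∩ C, IsH1Rectifiable K := fun K hK =>
    isH1Rectifiable_of_subset_iUnion hGcompact hGconn (hG ▸ hGfin) (hG ▸ hK)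
  have hfin : H1 (frontier A) ≠ ⊤ := ne_top_of_le_ne_top hGfin
    (measure_mono (frontier_subset_inter_of_union_eq_univ hA.isClosed hC.isClosed hAC))
  obtain ⟨h, hh, rfl⟩ := exists_height_of_kuratowskiTendsto hl hL hS hR hA hfin
  obtain ⟨K, H, hcl, hint⟩ := hh.exists_isHeightCrack hl hL hC.isClosed hAC hrect
  refine ⟨h, K, H, ⟨hcl ▸ hA, by rwa [hint, compl_compl]⟩,
    card_connectedComponents_le hGconn hGne ?_⟩
  rw [frontier, hcl, hint, sdiff_compl, ← hG]

theorem IsTwoLayer.closure_subset {l L : ℝ} (hl : 0 < l) (hL : 0 < L) {Λ : ℝ≥0∞}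
    {S₁ S₀ : Set Plane} (hS : IsTwoLayer l L Λ S₁ S₀) : closure S₀ ⊆ closure S₁ := by
  obtain ⟨h₁, K₁, h₀, K₀, H₁, H₀, rfl, rfl, hle, -⟩ := hS
  rwa [H₁.closure_eq hl hL, H₀.closure_eq hl hL,
    truncatedSubgraph_subset_iff fun x hx => (neg_nonpos.2 hL.le).trans (H₀.1.1 x hx).1]

theorem isTwoLayer_of_boundaryTendsto {l L : ℝ} (hl : 0 < l) (hL : 0 < L) {Λ : ℝ≥0∞}
    {S₁ S₀ : ℕ → Set Plane} (hS : ∀ k, IsTwoLayer l L Λ (S₁ k) (S₀ k)) {h₁ h₀ : ℝ → ℝ}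
    {K₁ K₀ : Set Plane} (H₁ : IsHeightCrack l L Λ h₁ K₁) (H₀ : IsHeightCrack l L Λ h₀ K₀)
    (hlim₁ : BoundaryTendsto S₁ atTop (crackedSubgraph l L h₁ K₁))
    (hlim₀ : BoundaryTendsto S₀ atTop (crackedSubgraph l L h₀ K₀)) :
    IsTwoLayer l L Λ (crackedSubgraph l L h₁ K₁) (crackedSubgraph l L h₀ K₀) := by
  refine ⟨h₁, K₁, h₀, K₀, H₁, H₀, rfl, rfl, ?_, ?_⟩
  · have hsub := hlim₀.closure.mono hlim₁.closure (.of_forall fun k => (hS k).closure_subset hl hL)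
    rwa [H₁.closure_eq hl hL, H₀.closure_eq hl hL,
      truncatedSubgraph_subset_iff fun x hx => (neg_nonpos.2 hL.le).trans (H₀.1.1 x hx).1] at hsub
  · rw [← disjoint_iff_inter_eq_empty, ← subset_compl_iff_disjoint_right]
    refine hlim₁.frontier.mono hlim₀.compl_interior (.of_forall fun k => ?_)
    obtain ⟨_, _, _, _, _, _, _, _, _, hempty⟩ := hS k
    rwa [subset_compl_iff_disjoint_right, disjoint_iff_inter_eq_empty]

theorem exists_tauConverges_subseq {l L R : ℝ} (hl : 0 < l) (hL : 0 < L) {Λ : ℝ≥0∞} {α : ℕ}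
    {m : Fin (α + 1) → ℕ} {S : ℕ → Fin (α + 1) → Set Plane}
    (hS : ∀ k, S k ∈ connMultilayers l L Λ α m)
    (hR : ∀ k i, closure (S k i) ⊆ truncatedSubgraph l L fun _ => R) {N : ℝ≥0∞} (hN : N ≠ ⊤)
    (hSN : ∀ k i, H1 (frontier (S k i)) ≤ N) :
    ∃ T ∈ connMultilayers l L Λ α m, ∃ θ : ℕ → ℕ, StrictMono θ ∧
      TauConverges (fun n => S (θ n)) T := by
  obtain ⟨θ, F, hθ, hF⟩ := exists_subseq_kuratowskiTendsto fun k =>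
    Sum.elim (fun i => closure (S k i)) fun i => (interior (S k i))ᶜ
  choose h K H hlim hcard using fun i => exists_isHeightCrack_boundaryTendsto hl hL
    (fun k => (hS (θ k)).1.1 i) (fun k => hR (θ k) i) (fun k => (hS (θ k)).2 i) hN
    (fun k => hSN (θ k) i) (hF (Sum.inl i)) (hF (Sum.inr i))
  have hadm : ∀ i, crackedSubgraph l L (h i) (K i) ∈ admissibleSubgraphs l L Λ := fun i =>
    ⟨h i, K i, H i, rfl⟩
  refine ⟨fun i => crackedSubgraph l L (h i) (K i), ⟨⟨hadm, fun i => ?_⟩, hcard⟩, θ, hθ,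
    fun i => (iSup_le fun k => hSN (θ k) i).trans_lt hN.lt_top, fun i => ?_⟩
  · exact isTwoLayer_of_boundaryTendsto hl hL (fun k => (hS (θ k)).1.2 i) (H _) (H _)
      (hlim _) (hlim _)
  · exact (hlim i).tendstoLocallyUniformly_sdist
      (nonempty_of_mem_admissibleSubgraphs hl hL (hadm i))
      ((frontier_nonempty_of_mem_admissibleSubgraphs hl hL (hadm i)).mono fun _ hx => hx.2)

/-! ### Bounded energy -/

theorem norm_normal (E : Set Plane) (x : Plane) : ‖normal E x‖ = 1 := by
  rw [normal]
  split_ifs with houter happrox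
  · exact houter.choose_spec.1
  · exact happrox.choose_spec.1
  · simp

theorem le_psi {φi φj φij : Plane → Plane → ℝ} {c : ℝ} {x : Plane} (hc : 0 ≤ c)
    (hi : ∀ ξ, c * ‖ξ‖ ≤ φi x ξ) (hj : ∀ ξ, c * ‖ξ‖ ≤ φj x ξ) (hij : ∀ ξ, c * ‖ξ‖ ≤ φij x ξ)
    (Sj Si : Set Plane) : c ≤ psi φi φj φij Sj Si x := by
  have hnormal : ∀ (φ : Plane → Plane → ℝ) (E : Set Plane), (∀ ξ, c * ‖ξ‖ ≤ φ x ξ) →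
      c ≤ φ x (normal E x) := fun φ E hφ => by
    simpa only [norm_normal, mul_one] using hφ (normal E x)
  have hφj := hnormal φj Sj hj
  have hφij := hnormal φij Si hij
  have htension1 : c ≤ tension1 φi φj φij x (normal Sj x) :=
    le_min (hnormal φi Sj hi) (by linarith [hnormal φij Sj hij])
  have htension2 : c ≤ tension2 φi φj x (normal Sj x) := le_min (hnormal φi Sj hi) hφj
  rw [psi]
  split_ifs <;> linarith

theorem mul_hausdorffMeasure_le_pairEnergy {l L : ℝ} {φi φj φij : Plane → Plane → ℝ} {c : ℝ}
    (hc : 0 ≤ c) (hi : ∀ x ∈ Omega l L, ∀ ξ, c * ‖ξ‖ ≤ φi x ξ)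
    (hj : ∀ x ∈ Omega l L, ∀ ξ, c * ‖ξ‖ ≤ φj x ξ)
    (hij : ∀ x ∈ Omega l L, ∀ ξ, c * ‖ξ‖ ≤ φij x ξ) (Sj Si : Set Plane) :
    ENNReal.ofReal c * H1 (Omega l L ∩ (frontier Si ∪ frontier Sj)) ≤
      pairEnergy l L φi φj φij Sj Si := by
  rw [pairEnergy, ← setLIntegral_const]
  refine setLIntegral_mono' ((isOpen_Omega l L).measurableSet.inter
    (isClosed_frontier.measurableSet.union isClosed_frontier.measurableSet)) fun x hx => ?_
  exact ENNReal.ofReal_le_ofReal (le_psi hc (hi x hx.1) (hj x hx.1) (hij x hx.1) Sj Si)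

theorem pairEnergy_le_surfaceEnergy (l L : ℝ) {α : ℕ} (φ : Fin (α + 1) → Plane → Plane → ℝ)
    (φφ : Fin (α + 1) → Fin (α + 1) → Plane → Plane → ℝ) (σ : Interaction)
    (S : Fin (α + 1) → Set Plane) (j : Fin α) :
    pairEnergy l L (φ j.castSucc) (φ j.succ) (φφ j.castSucc j.succ) (S j.succ) (S j.castSucc) ≤
      surfaceEnergy l L φ φφ σ S := by
  cases σ with
  | sequential =>
    exact Finset.single_le_sum (f := fun j : Fin α => pairEnergy l L (φ j.castSucc) (φ j.succ)
      (φφ j.castSucc j.succ) (S j.succ) (S j.castSucc)) (fun _ _ => zero_le) (Finset.mem_univ j)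
  | total =>
    refine le_trans ?_ (Finset.single_le_sum (f := fun j : Fin (α + 1) =>
      ∑ i ∈ Finset.univ.filter (fun i => i < j), pairEnergy l L (φ i) (φ j) (φφ i j) (S j) (S i))
      (fun _ _ => zero_le) (Finset.mem_univ j.succ))
    exact Finset.single_le_sum (f := fun i : Fin (α + 1) =>
      pairEnergy l L (φ i) (φ j.succ) (φφ i j.succ) (S j.succ) (S i)) (fun _ _ => zero_le)
      (Finset.mem_filter.2 ⟨Finset.mem_univ _, Fin.castSucc_lt_succ⟩)

theorem mul_hausdorffMeasure_le_surfaceEnergy {l L : ℝ} {α : ℕ} (hα : 1 ≤ α) {c : ℝ} (hc : 0 ≤ c)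
    {φ : Fin (α + 1) → Plane → Plane → ℝ} {φφ : Fin (α + 1) → Fin (α + 1) → Plane → Plane → ℝ}
    (hφ : ∀ j, ∀ x ∈ Omega l L, ∀ ξ, c * ‖ξ‖ ≤ φ j x ξ)
    (hφφ : ∀ i j, i < j → ∀ x ∈ Omega l L, ∀ ξ, c * ‖ξ‖ ≤ φφ i j x ξ) (σ : Interaction)
    (S : Fin (α + 1) → Set Plane) (i : Fin (α + 1)) :
    ENNReal.ofReal c * H1 (Omega l L ∩ frontier (S i)) ≤ surfaceEnergy l L φ φφ σ S := by
  obtain ⟨j, hj⟩ : ∃ j : Fin α, i = j.castSucc ∨ i = j.succ := by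
    rcases Fin.eq_zero_or_eq_succ i with rfl | ⟨j, rfl⟩
    exacts [⟨⟨0, hα⟩, Or.inl rfl⟩, ⟨j, Or.inr rfl⟩]
  have hsub : frontier (S i) ⊆ frontier (S j.castSucc) ∪ frontier (S j.succ) := by
    rcases hj with rfl | rfl
    exacts [subset_union_left, subset_union_right]
  calc ENNReal.ofReal c * H1 (Omega l L ∩ frontier (S i))
      ≤ ENNReal.ofReal c * H1 (Omega l L ∩ (frontier (S j.castSucc) ∪ frontier (S j.succ))) := by
        gcongr
    _ ≤ _ := mul_hausdorffMeasure_le_pairEnergy hc (hφ _) (hφ _)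
        (hφφ _ _ Fin.castSucc_lt_succ) _ _
    _ ≤ surfaceEnergy l L φ φφ σ S := pairEnergy_le_surfaceEnergy l L φ φφ σ S j

theorem closure_subset_closure_last {l L : ℝ} (hl : 0 < l) (hL : 0 < L) {Λ : ℝ≥0∞} {α : ℕ}
    {S : Fin (α + 1) → Set Plane} (hS : S ∈ multilayers l L Λ α) (i : Fin (α + 1)) :
    closure (S i) ⊆ closure (S (Fin.last α)) :=
  Fin.monotone_iff_le_succ (f := fun i => closure (S i)).2
    (fun i => (hS.2 i).closure_subset hl hL) (Fin.le_last i)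

theorem closure_subset_rectangle {l L : ℝ} (hl : 0 < l) (hL : 0 < L) {Λ : ℝ≥0∞} {S : Set Plane}
    (hS : S ∈ admissibleSubgraphs l L Λ) {M V : ℝ} (hM0 : 0 ≤ M) (hV0 : 0 ≤ V)
    (hΛ : Λ ≠ ⊤ ∨ S ⊆ closure (S ∩ Omega l L))
    (hM : H1 (Omega l L ∩ frontier S) ≤ ENNReal.ofReal M) (hV : volume S ≤ ENNReal.ofReal V) :
    closure S ⊆ truncatedSubgraph l L fun _ => max Λ.toReal (2 * M + V / l) := by
  obtain ⟨h, K, H, rfl⟩ := hS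
  have hcl := H.closure_eq hl hL
  rcases hΛ with hΛ | hΛ
  · rw [hcl, truncatedSubgraph_subset_iff fun x hx => (neg_nonpos.2 hL.le).trans (H.1.1 x hx).1]
    exact fun x hx => le_max_of_le_left ((ENNReal.ofReal_le_iff_le_toReal hΛ).1 (H.1.1 x hx).2)
  · have hfrontier : H1 (Omega l L ∩ frontier (truncatedSubgraph l L h)) ≤ ENNReal.ofReal M :=
      (measure_mono (inter_subset_inter_right _ (hcl ▸ frontier_closure_subset))).trans hM
    refine (closure_minimal hΛ isClosed_closure).trans
      (closure_minimal ?_ (isCompact_rectangle l L _).isClosed)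
    rintro p ⟨hp, hpΩ⟩
    rw [crackedSubgraph_eq hl] at hp
    refine ⟨hp.1.1, hp.1.2.1, le_max_of_le_right (hp.1.2.2.trans ?_)⟩
    exact height_le hl hL.le (fun x hx => (H.1.1 x hx).1) (H.1.isClosed_truncatedSubgraph hL.le)
      hM0 hV0 hfrontier (H.volume_eq hl ▸ hV) ⟨hpΩ.1, hpΩ.2.1⟩

theorem hausdorffMeasure_frontier_le {l L R : ℝ} {S : Set Plane}
    (hS : closure S ⊆ truncatedSubgraph l L fun _ => R) :
    H1 (frontier S) ≤
      H1 (Omega l L ∩ frontier S) + H1 ((truncatedSubgraph l L fun _ => R) \ Omega l L) := by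
  refine (measure_mono fun x hx => ?_).trans (measure_union_le _ _)
  by_cases hxΩ : x ∈ Omega l L
  exacts [Or.inl ⟨hxΩ, hx⟩, Or.inr ⟨hS (frontier_subset_closure hx), hxΩ⟩]

theorem exists_tauConverges_subseq_of_le {l L : ℝ} (hl : 0 < l) (hL : 0 < L) {Λ : ℝ≥0∞} {α : ℕ}
    {m : Fin (α + 1) → ℕ} {S : ℕ → Fin (α + 1) → Set Plane}
    (hS : ∀ k, S k ∈ connMultilayers l L Λ α m)
    (hΛ : Λ ≠ ⊤ ∨ ∀ k, S k (Fin.last α) ⊆ closure (S k (Fin.last α) ∩ Omega l L)) {M V : ℝ≥0∞}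
    (hM : M ≠ ⊤) (hV : V ≠ ⊤) (hSM : ∀ k i, H1 (Omega l L ∩ frontier (S k i)) ≤ M)
    (hSV : ∀ k, volume (S k (Fin.last α)) ≤ V) :
    ∃ T ∈ connMultilayers l L Λ α m, ∃ θ : ℕ → ℕ, StrictMono θ ∧
      TauConverges (fun n => S (θ n)) T := by
  lift M to ℝ≥0 using hM
  lift V to ℝ≥0 using hV
  have hrect : ∀ k i, closure (S k i) ⊆
      truncatedSubgraph l L fun _ => max Λ.toReal (2 * (M : ℝ) + V / l) := fun k i =>
    (closure_subset_closure_last hl hL (hS k).1 i).trans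
      (closure_subset_rectangle hl hL ((hS k).1.1 _) M.2 V.2 (hΛ.imp_right fun h => h k)
        (by simpa using hSM k _) (by simpa using hSV k))
  exact exists_tauConverges_subseq hl hL hS hrect
    (ENNReal.add_ne_top.2 ⟨ENNReal.coe_ne_top, hausdorffMeasure_rectangle_sdiff_ne_top l L _⟩)
    fun k i => (hausdorffMeasure_frontier_le (hrect k i)).trans (by gcongr; exact hSM k i)

end Multilayer

theorem mainTheorem7_general {l L : ℝ} (hl : 0 < l) (hL : 0 < L) {Λ : ℝ≥0∞} {α : ℕ} (hα : 1 ≤ α)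
    {m : Fin (α + 1) → ℕ} {σ : Multilayer.Interaction}
    {φ : Fin (α + 1) → Multilayer.Plane → Multilayer.Plane → ℝ}
    {φφ : Fin (α + 1) → Fin (α + 1) → Multilayer.Plane → Multilayer.Plane → ℝ} {c : ℝ} (hc : 0 < c)
    (hφ : ∀ j, ∀ x ∈ Multilayer.Omega l L, ∀ ξ, c * ‖ξ‖ ≤ φ j x ξ)
    (hφφ : ∀ i j, i < j → ∀ x ∈ Multilayer.Omega l L, ∀ ξ, c * ‖ξ‖ ≤ φφ i j x ξ)
    {S : ℕ → Fin (α + 1) → Set Multilayer.Plane}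
    (hS : ∀ k, S k ∈ Multilayer.connMultilayers l L Λ α m)
    (hΛ : Λ ≠ ⊤ ∨
      ∀ k, S k (Fin.last α) ⊆ closure (S k (Fin.last α) ∩ Multilayer.Omega l L))
    (hbound : (⨆ k, (Multilayer.surfaceEnergy l L φ φφ σ (S k) + volume (S k (Fin.last α)))) < ⊤) :
    ∃ T ∈ Multilayer.connMultilayers l L Λ α m, ∃ θ : ℕ → ℕ, StrictMono θ ∧
      Multilayer.TauConverges (fun n => S (θ n)) T := by
  have hle := le_iSup fun k => Multilayer.surfaceEnergy l L φ φφ σ (S k) +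
    volume (S k (Fin.last α))
  have hc0 : ENNReal.ofReal c ≠ 0 := (ENNReal.ofReal_pos.2 hc).ne'
  refine Multilayer.exists_tauConverges_subseq_of_le hl hL hS hΛ
    (ENNReal.div_ne_top hbound.ne hc0) hbound.ne (fun k i => ?_) fun k => le_add_self.trans (hle k)
  rw [ENNReal.le_div_iff_mul_le (.inl hc0) (.inl ENNReal.ofReal_ne_top), mul_comm]
  exact (Multilayer.mul_hausdorffMeasure_le_surfaceEnergy hα hc.le hφ hφφ σ (S k) i).trans
    (le_self_add.trans (hle k))

theorem mainTheorem7 (l L : ℝ) (hl : 0 < l) (hL : 0 < L) (Λ : ℝ≥0∞)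
    (α : ℕ) (hα : 1 ≤ α) (m : Fin (α + 1) → ℕ) (σ : Multilayer.Interaction)
    (φ : Fin (α + 1) → Multilayer.Plane → Multilayer.Plane → ℝ)
    (φφ : Fin (α + 1) → Fin (α + 1) → Multilayer.Plane → Multilayer.Plane → ℝ)
    (hφ : Multilayer.AdmissibleTensions l L φ φφ)
    (S : ℕ → Fin (α + 1) → Set Multilayer.Plane)
    (hS : ∀ k, S k ∈ Multilayer.connMultilayers l L Λ α m)
    (hΛ : Λ ≠ ⊤ ∨
      ∀ k, S k (Fin.last α) ⊆ closure (S k (Fin.last α) ∩ Multilayer.Omega l L))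
    (hbound : (⨆ k, (Multilayer.surfaceEnergy l L φ φφ σ (S k) + volume (S k (Fin.last α)))) < ⊤) :
    ∃ T ∈ Multilayer.connMultilayers l L Λ α m, ∃ θ : ℕ → ℕ, StrictMono θ ∧
      Multilayer.TauConverges (fun n => S (θ n)) T := by
  obtain ⟨c, _, hc, _, hv, hi⟩ := hφ.bounds
  exact mainTheorem7_general hl hL hα hc (fun j x hx ξ => (hv j x (subset_closure hx) ξ).1)
    (fun i j hij x hx ξ => ((hi i j hij).1 x (subset_closure hx) ξ).1) hS hΛ hbound
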